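/- Let $n\ge 45$ and $1\le r\le 2n+2$. A triangulation of a convex $n$-gon is a maximal set of pairwise non-crossing diagonals. A flip replaces a diagonal of a triangulation, which is one diagonal of a 4-gon whose four sides are edges of the triangulation (sides of the polygon or diagonals in the triangulation), by the other diagonal of this 4-gon. Let $\mathcal{A}_n$ (the associahedron) be the graph whose vertices are the triangulations of the convex $n$-gon and whose edges join triangulations that differ by a flip. The facet belonging to a diagonal $d$ is the set of all triangulations containing $d$. Then $\mathcal{A}_n$ has an $r$-rainbow cycle, that is, a cycle $C$ in $\mathcal{A}_n$ (without repeated vertices) such that, traversing $C$ once, each of the $\frac{n(n-3)}{2}$ diagonals of the $n$-gon is flipped (i.e. is the diagonal that is replaced) exactly $r$ times. Moreover, the following equivalence holds for every cycle $C$ in $\mathcal{A}_n$: each diagonal is flipped exactly $r$ times along $C$ if and only if, for each facet $f$ of $\mathcal{A}_n$, the intersection $C\cap f$ has exactly $r$ connected components along $C$ (i.e. the facet is visited in $r$ connected arcs). -/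

import Mathlib

/-- A diagonal of the convex `n`-gon with vertices `0, …, n - 1` in cyclic order: an unordered pair
of distinct vertices that is not a side of the polygon (the sides form the cycle graph). -/
def IsDiagonal {n : ℕ} (e : Sym2 (Fin n)) : Prop :=
  e ∈ (SimpleGraph.cycleGraph n)ᶜ.edgeSet

/-- Two chords of the convex `n`-gon cross (in their interiors) iff their end points interleave. -/
def Crosses {n : ℕ} (e f : Sym2 (Fin n)) : Prop :=
  ∃ a b c d : Fin n, a < b ∧ b < c ∧ c < d ∧
    ((e = s(a, c) ∧ f = s(b, d)) ∨ (e = s(b, d) ∧ f = s(a, c)))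

/-- A triangulation of the convex `n`-gon, given by its set of diagonals: an inclusion-maximal set
of pairwise non-crossing diagonals. -/
@[ext]
structure Triangulation (n : ℕ) where
  diagonals : Finset (Sym2 (Fin n))
  isDiagonal : ∀ e ∈ diagonals, IsDiagonal e
  noncrossing : ∀ e ∈ diagonals, ∀ f ∈ diagonals, ¬ Crosses e f
  maximal : ∀ e, IsDiagonal e → (∀ f ∈ diagonals, ¬ Crosses e f) → e ∈ diagonals

namespace Triangulation

variable {n : ℕ}

/-- `uv` is an edge of the triangulation: a side of the polygon or one of the diagonals. -/
def HasEdge (T : Triangulation n) (u v : Fin n) : Prop :=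
  (SimpleGraph.cycleGraph n).Adj u v ∨ s(u, v) ∈ T.diagonals

/-- `T'` arises from `T` by a flip: there is a 4-gon `abcd` (vertices in cyclic order) all of whose
sides are edges of `T` and which contains one of its diagonals `e` in `T`, and `T'` is obtained by
replacing `e` by the other diagonal `e'` of this 4-gon. -/
def IsFlip (T T' : Triangulation n) : Prop :=
  ∃ (a b c d : Fin n) (e e' : Sym2 (Fin n)), a < b ∧ b < c ∧ c < d ∧
    T.HasEdge a b ∧ T.HasEdge b c ∧ T.HasEdge c d ∧ T.HasEdge d a ∧
    ((e = s(a, c) ∧ e' = s(b, d)) ∨ (e = s(b, d) ∧ e' = s(a, c))) ∧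
    e ∈ T.diagonals ∧ T'.diagonals = insert e' (T.diagonals.erase e)

theorem IsFlip.symm {T T' : Triangulation n} (h : T.IsFlip T') : T'.IsFlip T := by
  obtain ⟨a, b, c, d, e, e', hab, hbc, hcd, h1, h2, h3, h4, hee, he, hT⟩ := h
  have key : ∀ u v, T.HasEdge u v → s(u, v) ≠ e → T'.HasEdge u v := by
    intro u v huv hne
    rcases huv with h | h
    · exact Or.inl h
    · right
      rw [hT]
      simp [hne, h]
  have hcr : Crosses e e' := ⟨a, b, c, d, hab, hbc, hcd, hee⟩
  have he' : e' ∉ T.diagonals := fun h => T.noncrossing e he e' h hcr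
  have hne : e ≠ e' := fun h => he' (h ▸ he)
  have hac := hab.trans hbc
  have hbd := hbc.trans hcd
  have had := hac.trans hcd
  refine ⟨a, b, c, d, e', e, hab, hbc, hcd, key _ _ h1 ?_, key _ _ h2 ?_, key _ _ h3 ?_,
    key _ _ h4 ?_, ?_, ?_, ?_⟩
  · rcases hee with ⟨rfl, -⟩ | ⟨rfl, -⟩ <;> simp <;> grind
  · rcases hee with ⟨rfl, -⟩ | ⟨rfl, -⟩ <;> simp <;> grind
  · rcases hee with ⟨rfl, -⟩ | ⟨rfl, -⟩ <;> simp <;> grind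
  · rcases hee with ⟨rfl, -⟩ | ⟨rfl, -⟩ <;> simp <;> grind
  · tauto
  · rw [hT]; simp
  · rw [hT]
    ext f
    simp only [Finset.mem_insert, Finset.mem_erase]
    grind

theorem IsFlip.ne {T T' : Triangulation n} (h : T.IsFlip T') : T ≠ T' := by
  obtain ⟨a, b, c, d, e, e', hab, hbc, hcd, -, -, -, -, hee, he, hT⟩ := h
  rintro rfl
  refine T.noncrossing e he e' ?_ ⟨a, b, c, d, hab, hbc, hcd, hee⟩
  rw [hT]; simp

end Triangulation

/-- The classical associahedron `𝒜ₙ`: the flip graph of the triangulations of the convex `n`-gon. -/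
def associahedron (n : ℕ) : SimpleGraph (Triangulation n) where
  Adj T T' := T.IsFlip T'
  symm := ⟨fun _ _ h => h.symm⟩
  loopless := ⟨fun _ h => h.ne rfl⟩

/-- The number of steps `T → T'` of a closed walk `C` in which the diagonal `d` is flipped, i.e. `d`
is the diagonal of `T` that is replaced when passing to `T'`. -/
def flipCount {n : ℕ} {T : Triangulation n} (C : (associahedron n).Walk T T)
    (d : Sym2 (Fin n)) : ℕ :=
  C.darts.countP fun s => d ∈ s.fst.diagonals ∧ d ∉ s.snd.diagonals

/-- An `r`-rainbow cycle: a cycle in the associahedron along which every diagonal of the polygon is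
flipped exactly `r` times. -/
def IsRainbowCycle {n : ℕ} (r : ℕ) {T : Triangulation n}
    (C : (associahedron n).Walk T T) : Prop :=
  C.IsCycle ∧ ∀ d : Sym2 (Fin n), IsDiagonal d → flipCount C d = r

/-- The facet of the associahedron that belongs to the diagonal `d`: all triangulations that
contain `d`. -/
def facet {n : ℕ} (d : Sym2 (Fin n)) : Set (Triangulation n) :=
  {T | d ∈ T.diagonals}

/-- The number of connected components of `C ∩ facet d`, where `C` is regarded as the graph formed
by its vertices and its edges. -/
noncomputable def facetArcs {n : ℕ} {T : Triangulation n} (C : (associahedron n).Walk T T)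
    (d : Sym2 (Fin n)) : ℕ :=
  Nat.card (C.toSubgraph.induce ({S | S ∈ C.support} ∩ facet d)).coe.ConnectedComponent

/-!
The rainbow cycle lives among the *snakes*, the triangulations whose dual tree is a path. In a snake
the diagonal at position `p` (for `1 ≤ p ≤ n - 3`) joins `x p` to `x p + p + 1` modulo `n`, where
`x : ℕ → ℤ` satisfies `x (p + 1) ∈ {x p, x p - 1}`. Raising one value `x p` by one, whenever the
result is again a snake, is a flip (`Snake.IsRaise.isFlip`), and any two snakes `U ≤ V` are joined by
a monotone walk of such flips inside the interval `[U, V]` (`Snake.Le.traverses`). Reading a snake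
from its other end gives the same triangulation with different coordinates (`Snake.glide`,
`Snake.tri_glide`). A monotone walk from `U` to the glide of `U` passes every diagonal exactly once:
the function `Snake.flips` counts the flips of a given diagonal along monotone walks, and it grows
by one under the glide (`Snake.flips_glide`). Hence a monotone walk that applies the glide `r` times
in total flips every diagonal `r` times, for every parity of `n` and of `r`, and it only remains to
make its triangulations distinct.

To this end round number `k < r` follows the zigzags `x p = ⌊(s - p) / 2⌋`, with stages
`s = 0, …, n`, but carries a marker, a set of positions (`Snake.mark`) that are always flipped ahead
and that spell the binary digits of `k`, once near each end of the snake. In each stage first the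
right part of the snake advances while the marker in the left part is at rest, then the left part
advances while the marker in the right part is at rest (`Snake.traverses_stage`). In the last stage
the marker of the next round is installed. The ends of the snake move last in each half of a stage,
so that they show the stage and its half; thus a triangulation determines its round and, as the sum
of the coordinates increases along a round, its place there (`Snake.InRound.eq_of_tri_eq`). There is
room for about `n / 4` binary digits, and `2 n + 2 ≤ 2 ^ ⌊(n - 11) / 4⌋` for `n ≥ 45`.

For the equivalence, consider a cycle that does not lie in the facet of `d`. The components of its
intersection with the facet are arcs, which correspond to the steps that leave the facet, that is, to
the flips of `d` (`facetArcs_eq_flipCount`). If a cycle lies in the facet of `d`, then `d` is never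
flipped and the facet of a diagonal crossing `d` is never visited, so that neither side of the
equivalence holds.
-/


/-! ### Vertices of the polygon as residues of integers -/

theorem Crosses.symm {n : ℕ} {e f : Sym2 (Fin n)} (h : Crosses e f) : Crosses f e := by
  obtain ⟨a, b, c, d, h1, h2, h3, h | h⟩ := h
  · exact ⟨a, b, c, d, h1, h2, h3, Or.inr ⟨h.2, h.1⟩⟩
  · exact ⟨a, b, c, d, h1, h2, h3, Or.inl ⟨h.2, h.1⟩⟩

theorem hasEdge_comm {n : ℕ} {T : Triangulation n} {u v : Fin n} : T.HasEdge u v ↔ T.HasEdge v u := by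
  rw [Triangulation.HasEdge, Triangulation.HasEdge, SimpleGraph.adj_comm, Sym2.eq_swap]

/-- The vertex of the `n`-gon onto which the integer `x` falls when `ℤ` is wound around it. -/
def vtx {n : ℕ} [hn : Fact (4 ≤ n)] (x : ℤ) : Fin n :=
  ⟨(x % n).toNat, by
    have h := hn.out
    have h1 := Int.emod_lt_of_pos x (show (0 : ℤ) < n by omega)
    have h2 := Int.emod_nonneg x (show (n : ℤ) ≠ 0 by omega)
    omega⟩

section Vertices

variable {n : ℕ} [hn : Fact (4 ≤ n)]

theorem not_dvd_of_pos_of_lt {m z : ℤ} (h0 : 0 < z) (h1 : z < m) : ¬ m ∣ z := fun h => by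
  have := Int.le_of_dvd h0 h
  omega

theorem vtx_eq_iff {x y : ℤ} : (vtx x : Fin n) = vtx y ↔ (n : ℤ) ∣ x - y := by
  have h := hn.out
  have h2 := Int.emod_nonneg x (show (n : ℤ) ≠ 0 by omega)
  have h3 := Int.emod_nonneg y (show (n : ℤ) ≠ 0 by omega)
  rw [← Int.emod_eq_emod_iff_emod_sub_eq_zero.trans Int.dvd_iff_emod_eq_zero.symm]
  simp only [vtx, Fin.mk.injEq]
  omega

theorem vtx_val (a : Fin n) : (vtx (a.val : ℤ) : Fin n) = a := by
  ext
  have := a.isLt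
  simp only [vtx]
  rw [Int.emod_eq_of_lt (by omega) (by omega)]
  simp

theorem vtx_add_mul (x k : ℤ) : (vtx (x + n * k) : Fin n) = vtx x := by
  rw [vtx_eq_iff]; exact ⟨k, by ring⟩

theorem vtx_add (x : ℤ) : (vtx (x + n) : Fin n) = vtx x := by
  rw [vtx_eq_iff]; exact ⟨1, by ring⟩

theorem vtx_val_of_lt {x : ℤ} (h0 : 0 ≤ x) (h1 : x < n) : ((vtx x : Fin n).val : ℤ) = x := by
  simp only [vtx]
  rw [Int.emod_eq_of_lt h0 h1]
  omega

/-- Every vertex is the image of an integer in a given window of length `n`. -/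
theorem exists_vtx_eq (a : Fin n) (x : ℤ) : ∃ u, x ≤ u ∧ u < x + n ∧ a = vtx u := by
  have h := hn.out
  refine ⟨x + (a.val - x) % n, ?_, ?_, ?_⟩
  · have := Int.emod_nonneg (a.val - x) (show (n : ℤ) ≠ 0 by omega)
    omega
  · have := Int.emod_lt_of_pos (a.val - x) (show (0 : ℤ) < n by omega)
    omega
  · conv_lhs => rw [← vtx_val a]
    rw [vtx_eq_iff]
    have := Int.dvd_self_sub_emod (x := (a.val : ℤ) - x) (m := n)
    convert this using 1
    ring

theorem eq_of_vtx_eq {x y : ℤ} (h : (vtx x : Fin n) = vtx y) (h1 : x - y < n) (h2 : y - x < n) :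
    x = y := by
  rw [vtx_eq_iff] at h
  have := Int.eq_zero_of_abs_lt_dvd h (by rw [abs_lt]; constructor <;> linarith)
  omega

theorem cycleGraph_adj_vtx {x y : ℤ} : (SimpleGraph.cycleGraph n).Adj (vtx x) (vtx y) ↔
    (n : ℤ) ∣ x - y - 1 ∨ (n : ℤ) ∣ y - x - 1 := by
  have key : ∀ x y : ℤ, ((vtx x : Fin n) - vtx y).val = 1 ↔ (n : ℤ) ∣ x - y - 1 := by
    intro x y
    have h := hn.out
    obtain ⟨u, hu1, hu2, hu⟩ := exists_vtx_eq (vtx x : Fin n) 0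
    obtain ⟨v, hv1, hv2, hv⟩ := exists_vtx_eq (vtx y : Fin n) 0
    have e1 : (n : ℤ) ∣ x - y - 1 ↔ (n : ℤ) ∣ u - v - 1 := by
      rw [vtx_eq_iff] at hu hv
      have := dvd_sub hu hv
      rw [show x - y - 1 = x - u - (y - v) + (u - v - 1) by ring, dvd_add_right this]
    rw [e1, hu, hv]
    have a1 := vtx_val_of_lt (n := n) hu1 (by omega)
    have a2 := vtx_val_of_lt (n := n) hv1 (by omega)
    rw [Fin.sub_def]
    simp only
    constructor
    · intro hh
      rcases lt_or_ge u v with hlt | hge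
      · rw [Nat.mod_eq_of_lt (by omega)] at hh
        exact ⟨-1, by omega⟩
      · rw [Nat.mod_eq_sub_mod (by omega), Nat.mod_eq_of_lt (by omega)] at hh
        exact ⟨0, by omega⟩
    · intro hh
      rcases lt_or_ge u v with hlt | hge
      · have : u - v - 1 = -n := by
          have := Int.eq_zero_of_abs_lt_dvd (m := n) (x := u - v - 1 + n)
            (dvd_add hh (dvd_refl _)) (by rw [abs_lt]; constructor <;> omega)
          omega
        rw [Nat.mod_eq_of_lt (by omega)]
        omega
      · have : u - v - 1 = 0 :=
          Int.eq_zero_of_abs_lt_dvd hh (by rw [abs_lt]; constructor <;> omega)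
        rw [Nat.mod_eq_sub_mod (by omega), Nat.mod_eq_of_lt (by omega)]
        omega
  rw [SimpleGraph.cycleGraph_adj', key, key]

theorem isDiagonal_vtx {x y : ℤ} : IsDiagonal (s(vtx x, vtx y) : Sym2 (Fin n)) ↔
    ¬ (n : ℤ) ∣ x - y ∧ ¬ (n : ℤ) ∣ x - y - 1 ∧ ¬ (n : ℤ) ∣ y - x - 1 := by
  rw [IsDiagonal, SimpleGraph.mem_edgeSet, SimpleGraph.compl_adj, cycleGraph_adj_vtx, ne_eq,
    vtx_eq_iff, not_or]

theorem isDiagonal_vtx_of_lt {x y : ℤ} (h1 : x + 2 ≤ y) (h2 : y + 2 ≤ x + n) :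
    IsDiagonal (s(vtx x, vtx y) : Sym2 (Fin n)) := by
  rw [Sym2.eq_swap, isDiagonal_vtx]
  refine ⟨not_dvd_of_pos_of_lt (by omega) (by omega), not_dvd_of_pos_of_lt (by omega) (by omega),
    fun h => not_dvd_of_pos_of_lt (m := n) (z := x - y - 1 + n) (by omega) (by omega)
      (dvd_add h (dvd_refl _))⟩

/-- A cyclically ordered quadruple of vertices has a rotation that is ordered in `Fin n`; the four
alternatives say which of the four vertices comes first. -/
theorem vtx_cyclic_order {x u y v : ℤ} (h1 : x < u) (h2 : u < y) (h3 : y < v) (h4 : v < x + n) :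
    ((vtx x : Fin n) < vtx u ∧ (vtx u : Fin n) < vtx y ∧ (vtx y : Fin n) < vtx v) ∨
    ((vtx u : Fin n) < vtx y ∧ (vtx y : Fin n) < vtx v ∧ (vtx v : Fin n) < vtx x) ∨
    ((vtx y : Fin n) < vtx v ∧ (vtx v : Fin n) < vtx x ∧ (vtx x : Fin n) < vtx u) ∨
    ((vtx v : Fin n) < vtx x ∧ (vtx x : Fin n) < vtx u ∧ (vtx u : Fin n) < vtx y) := by
  have hn4 := hn.out
  wlog hx : 0 ≤ x ∧ x < n generalizing x u y v
  · have := this (x := x + n * (-(x / n))) (u := u + n * (-(x / n))) (y := y + n * (-(x / n)))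
      (v := v + n * (-(x / n))) (by linarith) (by linarith) (by linarith) (by linarith)
      (by
        have e := Int.emod_add_mul_ediv x n
        have e1 := Int.emod_lt_of_pos x (show (0 : ℤ) < n by omega)
        have e2 := Int.emod_nonneg x (show (n : ℤ) ≠ 0 by omega)
        constructor <;> linarith)
    simpa only [vtx_add_mul] using this
  obtain ⟨hx0, hx1⟩ := hx
  have key : ∀ z : ℤ, x < z → z < x + n →
      (z < n ∧ ((vtx z : Fin n).val : ℤ) = z) ∨ (n ≤ z ∧ ((vtx z : Fin n).val : ℤ) = z - n) := by
    intro z hz1 hz2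
    rcases lt_or_ge z n with h | h
    · exact Or.inl ⟨h, vtx_val_of_lt (by omega) h⟩
    · refine Or.inr ⟨h, ?_⟩
      rw [← vtx_val_of_lt (n := n) (x := z - n) (by omega) (by omega), ← vtx_add (z - n)]
      simp
  have kx := vtx_val_of_lt (n := n) hx0 hx1
  have ku := key u (by omega) (by omega)
  have ky := key y (by omega) (by omega)
  have kv := key v (by omega) (by omega)
  simp only [Fin.lt_def]
  omega

theorem crosses_vtx {x u y v : ℤ} (h1 : x < u) (h2 : u < y) (h3 : y < v) (h4 : v < x + n) :
    Crosses (s(vtx x, vtx y) : Sym2 (Fin n)) s(vtx u, vtx v) := by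
  rcases vtx_cyclic_order h1 h2 h3 h4 with ⟨a, b, c⟩ | ⟨a, b, c⟩ | ⟨a, b, c⟩ | ⟨a, b, c⟩
  · exact ⟨_, _, _, _, a, b, c, Or.inl ⟨rfl, rfl⟩⟩
  · exact ⟨_, _, _, _, a, b, c, Or.inr ⟨Sym2.eq_swap, rfl⟩⟩
  · exact ⟨_, _, _, _, a, b, c, Or.inl ⟨Sym2.eq_swap, Sym2.eq_swap⟩⟩
  · exact ⟨_, _, _, _, a, b, c, Or.inr ⟨rfl, Sym2.eq_swap⟩⟩

theorem exists_of_crosses_vtx {x y : ℤ} {f : Sym2 (Fin n)} (hxy : x < y) (hyx : y < x + n)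
    (h : Crosses (s(vtx x, vtx y) : Sym2 (Fin n)) f) :
    ∃ u v : ℤ, x < u ∧ u < y ∧ y < v ∧ v < x + n ∧ f = s(vtx u, vtx v) := by
  -- integer representatives of the four interleaving end points, starting from `x`
  have key : ∀ p q r t : ℤ, p < q → q < r → r < t → t < p + n → (vtx x : Fin n) = vtx p →
      (vtx y : Fin n) = vtx r →
      ∃ u v : ℤ, x < u ∧ u < y ∧ y < v ∧ v < x + n ∧
        (s(vtx q, vtx t) : Sym2 (Fin n)) = s(vtx u, vtx v) := by
    intro p q r t h1 h2 h3 h4 hx hy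
    have hy' : y = x + (r - p) := by
      apply eq_of_vtx_eq (n := n) _ (by omega) (by omega)
      rw [hy, vtx_eq_iff]
      rw [vtx_eq_iff] at hx
      obtain ⟨k, hk⟩ := hx
      exact ⟨-k, by linarith⟩
    have hs : ∀ z, (vtx z : Fin n) = vtx (x + (z - p)) := by
      intro z
      rw [vtx_eq_iff] at hx ⊢
      obtain ⟨k, hk⟩ := hx
      exact ⟨-k, by linarith⟩
    exact ⟨x + (q - p), x + (t - p), by omega, by omega, by omega, by omega, by rw [hs q, hs t]⟩
  obtain ⟨a, b, c, d, hab, hbc, hcd, h⟩ := h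
  have ha := vtx_val a
  have hb := vtx_val b
  have hc := vtx_val c
  have hd := vtx_val d
  have hdn := d.isLt
  simp only [Fin.lt_def] at hab hbc hcd
  rcases h with ⟨he, rfl⟩ | ⟨he, rfl⟩
  · rw [Sym2.eq_iff] at he
    rcases he with ⟨hx, hy⟩ | ⟨hx, hy⟩
    · simpa only [hb, hd] using key a b c d (by omega) (by omega) (by omega) (by omega)
        (by rw [ha, hx]) (by rw [hc, hy])
    · simpa only [hb, hd, vtx_add, Sym2.eq_swap (a := d)] using key c d (a + n) (b + n) (by omega)
        (by omega) (by omega) (by omega) (by rw [hc, hx]) (by rw [vtx_add, ha, hy])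
  · rw [Sym2.eq_iff] at he
    rcases he with ⟨hx, hy⟩ | ⟨hx, hy⟩
    · simpa only [ha, hc, vtx_add, Sym2.eq_swap (a := c)] using key b c d (a + n) (by omega)
        (by omega) (by omega) (by omega) (by rw [hb, hx]) (by rw [hd, hy])
    · simpa only [ha, hc, vtx_add] using key d (a + n) (b + n) (c + n) (by omega)
        (by omega) (by omega) (by omega) (by rw [hd, hx]) (by rw [vtx_add, hb, hy])

theorem isFlip_of_vtx {T T' : Triangulation n} {x u y v : ℤ} (h1 : x < u) (h2 : u < y)
    (h3 : y < v) (h4 : v < x + n) (e1 : T.HasEdge (vtx x) (vtx u)) (e2 : T.HasEdge (vtx u) (vtx y))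
    (e3 : T.HasEdge (vtx y) (vtx v)) (e4 : T.HasEdge (vtx x) (vtx v))
    (he : s(vtx x, vtx y) ∈ T.diagonals)
    (hT : T'.diagonals = insert s(vtx u, vtx v) (T.diagonals.erase s(vtx x, vtx y))) :
    T.IsFlip T' := by
  rw [hasEdge_comm] at e4
  rcases vtx_cyclic_order h1 h2 h3 h4 with ⟨a, b, c⟩ | ⟨a, b, c⟩ | ⟨a, b, c⟩ | ⟨a, b, c⟩
  · exact ⟨_, _, _, _, _, _, a, b, c, e1, e2, e3, e4, Or.inl ⟨rfl, rfl⟩, he, hT⟩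
  · exact ⟨_, _, _, _, _, _, a, b, c, e2, e3, e4, e1, Or.inr ⟨Sym2.eq_swap, rfl⟩, he, hT⟩
  · exact ⟨_, _, _, _, _, _, a, b, c, e3, e4, e1, e2, Or.inl ⟨Sym2.eq_swap, Sym2.eq_swap⟩, he, hT⟩
  · exact ⟨_, _, _, _, _, _, a, b, c, e4, e1, e2, e3, Or.inr ⟨rfl, Sym2.eq_swap⟩, he, hT⟩

end Vertices

/-! ### Snakes and their triangulations -/

/-- A snake triangulation of the convex `n`-gon, whose dual tree is a path, in integer coordinates.
The diagonal at position `p ∈ {1, …, n - 3}` joins `left p` to `left p + p + 1`, and the diagonal at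
position `p + 1` arises from it by moving one of its two end points outwards by one. Values at
other positions play no role. -/
structure Snake (n : ℕ) where
  left : ℕ → ℤ
  step : ∀ p, 1 ≤ p → p + 4 ≤ n → left (p + 1) = left p ∨ left (p + 1) = left p - 1

/-- The chord of the `n`-gon that joins `x` to `x + p + 1`. -/
def chord {n : ℕ} [Fact (4 ≤ n)] (p : ℕ) (x : ℤ) : Sym2 (Fin n) :=
  s(vtx x, vtx (x + p + 1))

namespace Snake

variable {n : ℕ}

theorem left_mono (X : Snake n) {p q : ℕ} (hp : 1 ≤ p) (hpq : p ≤ q) (hq : q + 3 ≤ n) :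
    X.left q ≤ X.left p ∧ X.left p ≤ X.left q + (q - p : ℤ) := by
  induction q, hpq using Nat.le_induction with
  | base => simp
  | succ q hpq ih =>
    have := X.step q (by omega) (by omega)
    have := ih (by omega)
    push_cast
    omega

variable [hn : Fact (4 ≤ n)]

theorem chord_inj_left (X : Snake n) {p q : ℕ} (hp : 1 ≤ p) (hpq : p < q) (hq : q + 3 ≤ n) :
    (chord p (X.left p) : Sym2 (Fin n)) ≠ chord q (X.left q) := by
  intro h
  have hm := X.left_mono hp hpq.le hq
  rw [chord, chord, Sym2.eq_iff] at h
  rcases h with ⟨h1, h2⟩ | ⟨h1, h2⟩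
  · have h1 := eq_of_vtx_eq h1 (by omega) (by omega)
    have h2 := eq_of_vtx_eq h2 (by omega) (by omega)
    omega
  · have h1 := eq_of_vtx_eq h1.symm (by omega) (by omega)
    omega

theorem chord_injOn (X : Snake n) {p q : ℕ} (hp : 1 ≤ p) (hp' : p + 3 ≤ n) (hq : 1 ≤ q)
    (hq' : q + 3 ≤ n) (h : (chord p (X.left p) : Sym2 (Fin n)) = chord q (X.left q)) : p = q := by
  rcases lt_trichotomy p q with hlt | he | hlt
  · exact (X.chord_inj_left hp hlt hq' h).elim
  · exact he
  · exact (X.chord_inj_left hq hlt hp' h.symm).elim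

theorem not_crosses (X : Snake n) {p q : ℕ} (hp : 1 ≤ p) (hp' : p + 3 ≤ n) (hq : 1 ≤ q)
    (hq' : q + 3 ≤ n) :
    ¬ Crosses (chord p (X.left p) : Sym2 (Fin n)) (chord q (X.left q)) := by
  wlog hpq : p ≤ q generalizing p q
  · exact fun h => this hq hq' hp hp' (by omega) h.symm
  intro h
  have hm := X.left_mono hp hpq hq'
  obtain ⟨u, v, h1, h2, h3, h4, h5⟩ := exists_of_crosses_vtx (by omega) (by omega) h
  -- the end point `u` would lie strictly inside the arc of the longer chord
  rw [chord, Sym2.eq_iff] at h5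
  rcases h5 with ⟨h5, -⟩ | ⟨-, h5⟩
  · have := eq_of_vtx_eq h5 (by omega) (by omega)
    omega
  · have := eq_of_vtx_eq h5 (by omega) (by omega)
    omega

/-- A diagonal spanned by vertices of the arc of position `p` that crosses no diagonal of the snake
is a diagonal of the snake: it cannot be separated from the newest vertex of the arc. -/
theorem exists_chord_of_arc (X : Snake n) {u v : ℤ} (huv : u + 2 ≤ v) (p : ℕ) (hp : 1 ≤ p)
    (hp' : p + 3 ≤ n) (hu : X.left p ≤ u) (hv : v ≤ X.left p + p + 1)
    (hc : ∀ q, 1 ≤ q → q + 3 ≤ n →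
      ¬ Crosses (s(vtx u, vtx v) : Sym2 (Fin n)) (chord q (X.left q))) :
    ∃ q, 1 ≤ q ∧ q + 3 ≤ n ∧ (s(vtx u, vtx v) : Sym2 (Fin n)) = chord q (X.left q) := by
  induction p, hp using Nat.le_induction with
  | base =>
    refine ⟨1, le_rfl, hp', ?_⟩
    rw [chord, show u = X.left 1 by push_cast at hv; omega,
      show v = X.left 1 + (1 : ℕ) + 1 by push_cast at hv ⊢; omega]
  | succ p hp ih =>
    have hcp := hc p hp (by omega)
    push_cast at hv
    by_cases hin : X.left p ≤ u ∧ v ≤ X.left p + p + 1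
    · exact ih (by omega) hin.1 hin.2
    · rcases X.step p hp (by omega) with hs | hs
      · by_cases hu' : X.left p < u
        · exact (hcp (crosses_vtx (x := X.left p) hu' (y := X.left p + p + 1) (by omega)
            (v := v) (by omega) (by omega)).symm).elim
        · refine ⟨p + 1, by omega, hp', ?_⟩
          rw [chord, show u = X.left (p + 1) by omega,
            show v = X.left (p + 1) + (p + 1 : ℕ) + 1 by push_cast; omega]
      · by_cases hv' : v < X.left p + p + 1
        · have := crosses_vtx (n := n) (x := X.left p) (u := v) (by omega)
            (y := X.left p + p + 1) hv' (v := u + n) (by omega) (by omega)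
          rw [vtx_add, Sym2.eq_swap (a := vtx v)] at this
          exact (hcp this.symm).elim
        · refine ⟨p + 1, by omega, hp', ?_⟩
          rw [chord, show u = X.left (p + 1) by omega,
            show v = X.left (p + 1) + (p + 1 : ℕ) + 1 by push_cast; omega]

theorem exists_chord (X : Snake n) {e : Sym2 (Fin n)} (he : IsDiagonal e)
    (hc : ∀ q, 1 ≤ q → q + 3 ≤ n → ¬ Crosses e (chord q (X.left q))) :
    ∃ q, 1 ≤ q ∧ q + 3 ≤ n ∧ e = chord q (X.left q) := by
  have hn4 := hn.out
  induction e using Sym2.ind with | _ a b => ?_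
  -- the vertex `left (n - 3) - 1` is the only one outside the arc of the last position
  set N := n - 3 with hN
  obtain ⟨u, hu1, hu2, rfl⟩ := exists_vtx_eq a (X.left N - 1)
  obtain ⟨v, hv1, hv2, rfl⟩ := exists_vtx_eq b (X.left N - 1)
  wlog huv : u ≤ v generalizing u v
  · rw [Sym2.eq_swap] at he hc ⊢
    exact this v hv1 hv2 u hu1 hu2 he hc (by omega)
  obtain ⟨d1, d2, d3⟩ := isDiagonal_vtx.1 he
  have h1 : u ≠ v := by rintro rfl; simp at d1
  have h2 : v ≠ u + 1 := by rintro rfl; simp at d3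
  have hd : ¬ (n : ℤ) ∣ u - v - 1 + n := fun h => d2 ((dvd_add_left (dvd_refl _)).1 h)
  have h3 : v ≠ u + n - 1 := by
    rintro rfl
    apply hd
    ring_nf
    simp
  by_cases hu : X.left N ≤ u
  · exact X.exists_chord_of_arc (by omega) N (by omega) (by omega) hu (by omega) hc
  · refine ((hc N (by omega) (by omega)) ?_).elim
    have := crosses_vtx (n := n) (x := X.left N) (u := v) (by omega)
      (y := X.left N + N + 1) (by omega) (v := u + n) (by omega) (by omega)
    rw [vtx_add, Sym2.eq_swap (a := vtx v)] at this
    exact this.symm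

/-- The triangulation formed by the diagonals of a snake. -/
def tri (X : Snake n) : Triangulation n where
  diagonals := (Finset.Icc 1 (n - 3)).image fun p => chord p (X.left p)
  isDiagonal := by
    have hn4 := hn.out
    intro e he
    simp only [Finset.mem_image, Finset.mem_Icc] at he
    obtain ⟨p, hp, rfl⟩ := he
    exact isDiagonal_vtx_of_lt (by omega) (by omega)
  noncrossing := by
    have hn4 := hn.out
    intro e he f hf
    simp only [Finset.mem_image, Finset.mem_Icc] at he hf
    obtain ⟨p, hp, rfl⟩ := he
    obtain ⟨q, hq, rfl⟩ := hf
    exact X.not_crosses hp.1 (by omega) hq.1 (by omega)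
  maximal := by
    have hn4 := hn.out
    intro e he hc
    simp only [Finset.mem_image, Finset.mem_Icc] at hc ⊢
    obtain ⟨q, hq, hq', rfl⟩ := X.exists_chord he
      fun q hq hq' => hc _ ⟨q, ⟨hq, by omega⟩, rfl⟩
    exact ⟨q, ⟨hq, by omega⟩, rfl⟩

theorem mem_tri {X : Snake n} {e : Sym2 (Fin n)} :
    e ∈ X.tri.diagonals ↔ ∃ p, 1 ≤ p ∧ p + 3 ≤ n ∧ e = chord p (X.left p) := by
  have hn4 := hn.out
  simp only [tri, Finset.mem_image, Finset.mem_Icc]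
  constructor
  · rintro ⟨p, hp, rfl⟩
    exact ⟨p, hp.1, by omega, rfl⟩
  · rintro ⟨p, hp, hp', rfl⟩
    exact ⟨p, ⟨hp, by omega⟩, rfl⟩

theorem tri_congr {X Y : Snake n} (h : ∀ p, 1 ≤ p → p + 3 ≤ n → X.left p = Y.left p) :
    X.tri = Y.tri := by
  ext e
  rw [mem_tri, mem_tri]
  constructor <;> rintro ⟨p, hp, hp', rfl⟩ <;> exact ⟨p, hp, hp', by rw [h p hp hp']⟩

/-- Reading a snake from its other end: position `p` becomes position `n - 2 - p`. -/
def glide (X : Snake n) : Snake n where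
  left p := X.left (n - 2 - p) + ((n - 2 - p : ℕ) : ℤ) + 1
  step p hp hp' := by
    have := X.step (n - 2 - (p + 1)) (by omega) (by omega)
    rw [show n - 2 - (p + 1) + 1 = n - 2 - p by omega] at this
    push_cast [show p + 1 ≤ n - 2 by omega, show p ≤ n - 2 by omega, show 2 ≤ n by omega]
    omega

theorem chord_glide {p q : ℕ} (h : p + q + 2 = n) (x : ℤ) :
    (chord p (x + q + 1) : Sym2 (Fin n)) = chord q x := by
  have e : (vtx (x + q + 1 + p + 1) : Fin n) = vtx x := by
    rw [← vtx_add x]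
    congr 1
    omega
  rw [chord, chord, Sym2.eq_swap, e]

theorem tri_glide (X : Snake n) : X.glide.tri = X.tri := by
  ext e
  rw [mem_tri, mem_tri]
  constructor
  · rintro ⟨p, hp, hp', rfl⟩
    exact ⟨n - 2 - p, by omega, by omega, chord_glide (by omega) _⟩
  · rintro ⟨p, hp, hp', rfl⟩
    refine ⟨n - 2 - p, by omega, by omega, ?_⟩
    rw [glide]
    simp only
    rw [show n - 2 - (n - 2 - p) = p by omega]
    exact (chord_glide (by omega) _).symm

/-- `Y` arises from `X` by moving the diagonal at position `p` one step forward. -/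
structure IsRaise (X Y : Snake n) (p : ℕ) : Prop where
  one_le : 1 ≤ p
  le : p + 3 ≤ n
  eq : Y.left p = X.left p + 1
  eq_of_ne : ∀ q, 1 ≤ q → q + 3 ≤ n → q ≠ p → Y.left q = X.left q

/-- Moving a diagonal of a snake forward flips it. -/
theorem IsRaise.isFlip {X Y : Snake n} {p : ℕ} (h : IsRaise X Y p) : X.tri.IsFlip Y.tri := by
  have hn4 := hn.out
  have h1 := h.one_le
  have h2 := h.le
  have h3 := h.eq
  have mem : ∀ q, 1 ≤ q → q + 3 ≤ n → (chord q (X.left q) : Sym2 (Fin n)) ∈ X.tri.diagonals :=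
    fun q hq hq' => mem_tri.2 ⟨q, hq, hq', rfl⟩
  have side : ∀ x : ℤ, X.tri.HasEdge (vtx x) (vtx (x + 1)) := fun x =>
    Or.inl (cycleGraph_adj_vtx.2 (Or.inr (by simp)))
  set x := X.left p with hx
  have down : X.tri.HasEdge (vtx (x + 1)) (vtx (x + p + 1)) := by
    rcases Nat.lt_or_ge 1 p with hp | hp
    · have hs := X.step (p - 1) (by omega) (by omega)
      have hs' := Y.step (p - 1) (by omega) (by omega)
      rw [show p - 1 + 1 = p by omega] at hs hs'
      rw [h.eq_of_ne (p - 1) (by omega) (by omega) (by omega)] at hs'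
      right
      convert mem (p - 1) (by omega) (by omega) using 1
      rw [chord, show X.left (p - 1) = x + 1 by omega]
      congr 3
      push_cast [show 1 ≤ p by omega]
      ring
    · have : p = 1 := by omega
      have := side (x + 1)
      rwa [show x + p + 1 = x + 1 + 1 by omega]
  have up : X.tri.HasEdge (vtx x) (vtx (x + p + 2)) := by
    rcases Nat.lt_or_ge (p + 3) n with hp | hp
    · have hs := X.step p (by omega) (by omega)
      have hs' := Y.step p (by omega) (by omega)
      rw [h.eq_of_ne (p + 1) (by omega) (by omega) (by omega)] at hs'
      right
      convert mem (p + 1) (by omega) (by omega) using 1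
      rw [chord, show X.left (p + 1) = x by omega,
        show x + p + 2 = x + (p + 1 : ℕ) + 1 by push_cast; ring]
    · have hs := side (x - 1)
      rw [hasEdge_comm, ← vtx_add (x - 1)] at hs
      rwa [show x - 1 + 1 = x by ring, show x - 1 + n = x + p + 2 by omega] at hs
  refine isFlip_of_vtx (x := x) (u := x + 1) (y := x + p + 1) (v := x + p + 2) (by omega)
    (by omega) (by omega) (by omega) (side x) down ?_ up (mem p h1 h2) ?_
  · have := side (x + p + 1)
    rwa [show x + p + 1 + 1 = x + p + 2 by ring] at this
  · have hY : (chord p (Y.left p) : Sym2 (Fin n)) = s(vtx (x + 1), vtx (x + p + 2)) := by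
      rw [chord, h3, show x + 1 + p + 1 = x + p + 2 by ring]
    ext e
    rw [mem_tri, Finset.mem_insert, Finset.mem_erase, mem_tri, ← hY]
    change _ ↔ _ ∨ e ≠ chord p x ∧ _
    constructor
    · rintro ⟨q, hq, hq', rfl⟩
      by_cases hqp : q = p
      · left; rw [hqp]
      · right
        rw [h.eq_of_ne q hq hq' hqp]
        exact ⟨fun he => hqp (X.chord_injOn hq hq' h1 h2 he), q, hq, hq', rfl⟩
    · rintro (rfl | ⟨hne, q, hq, hq', rfl⟩)
      · exact ⟨p, h1, h2, rfl⟩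
      · have hqp : q ≠ p := by rintro rfl; exact hne rfl
        exact ⟨q, hq, hq', by rw [h.eq_of_ne q hq hq' hqp]⟩

theorem IsRaise.mem_and_not_mem_iff {X Y : Snake n} {p : ℕ} (h : IsRaise X Y p)
    {e : Sym2 (Fin n)} :
    e ∈ X.tri.diagonals ∧ e ∉ Y.tri.diagonals ↔ e = chord p (X.left p) := by
  rw [mem_tri, mem_tri]
  constructor
  · rintro ⟨⟨q, hq, hq', rfl⟩, hY⟩
    by_cases hqp : q = p
    · rw [hqp]
    · exact (hY ⟨q, hq, hq', by rw [h.eq_of_ne q hq hq' hqp]⟩).elim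
  · rintro rfl
    refine ⟨⟨p, h.one_le, h.le, rfl⟩, ?_⟩
    rintro ⟨q, hq, hq', he⟩
    have h1 := h.one_le
    have h2 := h.le
    by_cases hqp : q = p
    · subst hqp
      rw [h.eq, chord, chord, Sym2.eq_iff] at he
      rcases he with ⟨he, -⟩ | ⟨he, -⟩
      · have := eq_of_vtx_eq he (by omega) (by omega)
        omega
      · have := eq_of_vtx_eq he (by omega) (by omega)
        omega
    · rw [h.eq_of_ne q hq hq' hqp] at he
      exact hqp (X.chord_injOn h1 h2 hq hq' he).symm

end Snake

namespace Snake

variable {n : ℕ}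

/-! ### Order, area and flip counts of snakes -/

/-- `X ≤ Y` at all positions. -/
def Le (X Y : Snake n) : Prop :=
  ∀ p, 1 ≤ p → p + 3 ≤ n → X.left p ≤ Y.left p

/-- The sum of the coordinates of a snake, which grows by one with every step of a monotone walk. -/
def area (X : Snake n) : ℤ :=
  ∑ p ∈ Finset.Icc 1 (n - 3), X.left p

theorem IsRaise.area_eq {X Y : Snake n} {p : ℕ} (h : IsRaise X Y p) : Y.area = X.area + 1 := by
  have hp : p ∈ Finset.Icc 1 (n - 3) := Finset.mem_Icc.2 ⟨h.one_le, by have := h.le; omega⟩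
  rw [area, area, ← Finset.add_sum_erase _ _ hp, ← Finset.add_sum_erase _ _ hp, h.eq,
    Finset.sum_congr rfl (g := X.left)]
  · ring
  · intro q hq
    rw [Finset.mem_erase, Finset.mem_Icc] at hq
    exact h.eq_of_ne q hq.2.1 (by have := h.le; omega) hq.1

/-- How often a diagonal `uv` with `u < v` has been flipped up to a reference level on the way to
the snake `X`. The diagonal occurs at position `v - u - 1` with left end point congruent to `u`, and
at the mirrored position with left end point congruent to `v`. -/
def flips (u v : ℕ) (X : Snake n) : ℤ :=
  (X.left (v - u - 1) - 1 - u) / n + (X.left (n - 1 - (v - u)) - 1 - v) / n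

theorem flips_congr {u v : ℕ} (h1 : u + 2 ≤ v) (h2 : v + 2 ≤ u + n) {X Y : Snake n}
    (h : ∀ p, 1 ≤ p → p + 3 ≤ n → X.left p = Y.left p) : X.flips u v = Y.flips u v := by
  rw [flips, flips, h _ (by omega) (by omega), h _ (by omega) (by omega)]

theorem add_one_ediv {m z : ℤ} (hm : 0 < m) :
    (z + 1) / m = z / m + if m ∣ z + 1 then 1 else 0 := by
  have e := Int.emod_add_mul_ediv z m
  have h1 := Int.emod_lt_of_pos z hm
  have h2 := Int.emod_nonneg z hm.ne'
  have key : m ∣ z + 1 ↔ m ∣ z % m + 1 := by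
    rw [show z + 1 = z % m + 1 + m * (z / m) by linarith]
    exact dvd_add_left (dvd_mul_right _ _)
  split_ifs with h
  · have h3 : z % m + 1 = m := by
      have := Int.le_of_dvd (by omega) (key.1 h)
      omega
    rw [show z + 1 = m * (z / m + 1) by linarith, Int.mul_ediv_cancel_left _ hm.ne']
  · have h3 : z % m + 1 ≠ m := fun h' => h (key.2 (by rw [h']))
    rw [show z + 1 = z % m + 1 + m * (z / m) by linarith, Int.add_mul_ediv_left _ _ hm.ne',
      Int.ediv_eq_zero_of_lt (by omega) (by omega)]
    ring

variable [hn : Fact (4 ≤ n)]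

/-! ### When two snakes have the same triangulation -/

theorem exists_eq_add_of_tri_eq_of_dvd {X Y : Snake n} (h : X.tri = Y.tri)
    (h1 : (n : ℤ) ∣ Y.left 1 - X.left 1) :
    ∃ m : ℤ, ∀ p, 1 ≤ p → p + 3 ≤ n → Y.left p = X.left p + n * m := by
  have hn4 := hn.out
  obtain ⟨m, hm⟩ := h1
  refine ⟨m, fun p hp => ?_⟩
  induction p, hp using Nat.le_induction with
  | base => intro _; linarith
  | succ p hp ih =>
    intro hp'
    have ih := ih (by omega)
    have hX := X.step p hp (by omega)
    have hmem : (chord (p + 1) (X.left (p + 1)) : Sym2 (Fin n)) ∈ Y.tri.diagonals :=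
      h ▸ mem_tri.2 ⟨p + 1, by omega, hp', rfl⟩
    obtain ⟨q, hq, hq', he⟩ := mem_tri.1 hmem
    rw [chord, chord, Sym2.eq_iff, vtx_eq_iff, vtx_eq_iff, vtx_eq_iff, vtx_eq_iff] at he
    push_cast at he
    rcases he with ⟨e1, e2⟩ | ⟨e1, e2⟩
    · have hqp : (p : ℤ) + 1 - q = 0 := by
        refine Int.eq_zero_of_abs_lt_dvd (m := n) ?_ (by rw [abs_lt]; constructor <;> omega)
        have := dvd_sub e2 e1
        ring_nf at this ⊢
        exact this
      obtain rfl : q = p + 1 := by omega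
      have hY := Y.step p hp (by omega)
      have : X.left (p + 1) - Y.left (p + 1) + n * m = 0 :=
        Int.eq_zero_of_abs_lt_dvd (dvd_add e1 (dvd_mul_right _ _))
          (by rw [abs_lt]; constructor <;> omega)
      linarith
    · -- the two chords would lie on opposite sides of the arc of position `p`
      exfalso
      have hqp : (p : ℤ) + q + 3 - n = 0 := by
        refine Int.eq_zero_of_abs_lt_dvd (m := n) ?_ (by rw [abs_lt]; constructor <;> omega)
        have := dvd_sub (dvd_sub e2 e1) (dvd_refl (n : ℤ))
        ring_nf at this ⊢
        exact this
      have hz : (n : ℤ) ∣ X.left (p + 1) + (p + 1) + 1 - Y.left q + n * m :=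
        dvd_add e2 (dvd_mul_right _ _)
      rcases le_total p q with hpq | hpq
      · have := Y.left_mono hp hpq hq'
        exact not_dvd_of_pos_of_lt (by omega) (by omega) hz
      · have := Y.left_mono hq hpq (by omega)
        exact not_dvd_of_pos_of_lt (by omega) (by omega) hz

/-- Snakes with the same triangulation agree up to a rotation by a multiple of `n`, possibly after
one of them is read from its other end: the diagonals at the two ends of a snake are its only
ears. -/
theorem exists_eq_add_of_tri_eq {X Y : Snake n} (h : X.tri = Y.tri) :
    ∃ m : ℤ, (∀ p, 1 ≤ p → p + 3 ≤ n → Y.left p = X.left p + n * m) ∨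
      (∀ p, 1 ≤ p → p + 3 ≤ n → Y.glide.left p = X.left p + n * m) := by
  have hn4 := hn.out
  have hmem : (chord 1 (X.left 1) : Sym2 (Fin n)) ∈ Y.tri.diagonals :=
    h ▸ mem_tri.2 ⟨1, le_rfl, by omega, rfl⟩
  obtain ⟨q, hq, hq', he⟩ := mem_tri.1 hmem
  rw [chord, chord, Sym2.eq_iff, vtx_eq_iff, vtx_eq_iff, vtx_eq_iff, vtx_eq_iff] at he
  push_cast at he
  rcases he with ⟨e1, e2⟩ | ⟨e1, e2⟩
  · have hqp : (1 : ℤ) - q = 0 := by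
      refine Int.eq_zero_of_abs_lt_dvd (m := n) ?_ (by rw [abs_lt]; constructor <;> omega)
      have := dvd_sub e2 e1
      ring_nf at this ⊢
      exact this
    obtain rfl : q = 1 := by omega
    obtain ⟨m, hm⟩ := exists_eq_add_of_tri_eq_of_dvd h ((dvd_sub_comm).1 e1)
    exact ⟨m, Or.inl hm⟩
  · have hqp : (q : ℤ) + 3 - n = 0 := by
      refine Int.eq_zero_of_abs_lt_dvd (m := n) ?_ (by rw [abs_lt]; constructor <;> omega)
      have := dvd_sub (dvd_sub e2 e1) (dvd_refl (n : ℤ))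
      ring_nf at this ⊢
      exact this
    obtain ⟨m, hm⟩ := exists_eq_add_of_tri_eq_of_dvd (Y := Y.glide) (h.trans Y.tri_glide.symm) (by
      rw [glide]
      simp only
      rw [show n - 2 - 1 = q by omega, dvd_sub_comm]
      convert e1 using 1)
    exact ⟨m, Or.inr hm⟩

/-! ### Monotone walks between snakes -/

theorem area_congr {X Y : Snake n} (h : ∀ p, 1 ≤ p → p + 3 ≤ n → X.left p = Y.left p) :
    X.area = Y.area := by
  have hn4 := hn.out
  refine Finset.sum_congr rfl fun p hp => ?_
  rw [Finset.mem_Icc] at hp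
  exact h p hp.1 (by omega)

theorem Le.area_le {X Y : Snake n} (h : Le X Y) : X.area ≤ Y.area := by
  have hn4 := hn.out
  refine Finset.sum_le_sum fun p hp => ?_
  rw [Finset.mem_Icc] at hp
  exact h p hp.1 (by omega)

theorem flips_glide {u v : ℕ} (h1 : u + 2 ≤ v) (h2 : v + 2 ≤ u + n) (X : Snake n) :
    X.glide.flips u v = X.flips u v + 1 := by
  have hn4 := hn.out
  rw [flips, flips, glide]
  simp only
  rw [show n - 2 - (v - u - 1) = n - 1 - (v - u) by omega,
    show n - 2 - (n - 1 - (v - u)) = v - u - 1 by omega,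
    show X.left (n - 1 - (v - u)) + ((n - 1 - (v - u) : ℕ) : ℤ) + 1 - 1 - u =
      (X.left (n - 1 - (v - u)) - 1 - v) + n * 1 by omega,
    show X.left (v - u - 1) + ((v - u - 1 : ℕ) : ℤ) + 1 - 1 - v = X.left (v - u - 1) - 1 - u by
      omega,
    Int.add_mul_ediv_left _ _ (by omega)]
  ring

theorem IsRaise.flips_eq {u v : ℕ} (h1 : u + 2 ≤ v) (h3 : v + 2 ≤ u + n)
    {X Y : Snake n} {p : ℕ} (h : IsRaise X Y p) :
    Y.flips u v = X.flips u v +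
      if (s(vtx u, vtx v) : Sym2 (Fin n)) = chord p (X.left p) then 1 else 0 := by
  have hn4 := hn.out
  have hp1 := h.one_le
  have hp2 := h.le
  have key : (s(vtx u, vtx v) : Sym2 (Fin n)) = chord p (X.left p) ↔
      (v - u - 1 = p ∧ (n : ℤ) ∣ X.left p - u) ∨ (n - 1 - (v - u) = p ∧ (n : ℤ) ∣ X.left p - v) := by
    rw [chord, eq_comm, Sym2.eq_iff, vtx_eq_iff, vtx_eq_iff, vtx_eq_iff, vtx_eq_iff]
    refine or_congr ⟨fun ⟨e1, e2⟩ => ⟨?_, e1⟩, fun ⟨e1, e2⟩ => ⟨e2, ?_⟩⟩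
      ⟨fun ⟨e1, e2⟩ => ⟨?_, e1⟩, fun ⟨e1, e2⟩ => ⟨e2, ?_⟩⟩
    · have : (p : ℤ) + 1 + u - v = 0 := by
        refine Int.eq_zero_of_abs_lt_dvd (m := n) ?_ (by rw [abs_lt]; constructor <;> omega)
        have := dvd_sub e2 e1
        ring_nf at this ⊢
        exact this
      omega
    · convert e2 using 1
      omega
    · have : (p : ℤ) + 1 + v - u - n = 0 := by
        refine Int.eq_zero_of_abs_lt_dvd (m := n) ?_ (by rw [abs_lt]; constructor <;> omega)
        have := dvd_sub (dvd_sub e2 e1) (dvd_refl (n : ℤ))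
        ring_nf at this ⊢
        exact this
      omega
    · rw [show X.left p + p + 1 - u = X.left p - v + n by omega]
      exact dvd_add e2 (dvd_refl _)
  have hdiv : ∀ (q : ℕ) (w : ℤ), 1 ≤ q → q + 3 ≤ n → (Y.left q - 1 - w) / n =
      (X.left q - 1 - w) / n + if q = p ∧ (n : ℤ) ∣ X.left p - w then 1 else 0 := by
    intro q w hq hq'
    by_cases hqp : q = p
    · subst hqp
      have := add_one_ediv (m := n) (z := X.left q - 1 - w) (by omega)
      rw [h.eq, show X.left q + 1 - 1 - w = X.left q - 1 - w + 1 by ring, this,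
        show X.left q - 1 - w + 1 = X.left q - w by ring]
      simp
    · rw [h.eq_of_ne q hq hq' hqp]
      simp [hqp]
  rw [flips, flips, hdiv _ _ (by omega) (by omega), hdiv _ _ (by omega) (by omega),
    if_congr key rfl rfl]
  have hexcl : ¬ ((n : ℤ) ∣ X.left p - u ∧ (n : ℤ) ∣ X.left p - v) := fun ⟨a, b⟩ =>
    not_dvd_of_pos_of_lt (m := n) (z := (v : ℤ) - u) (by omega) (by omega) (by
      have := dvd_sub a b
      rwa [show X.left p - u - (X.left p - v) = (v : ℤ) - u by ring] at this)
  by_cases a : v - u - 1 = p ∧ (n : ℤ) ∣ X.left p - u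
  · have b : ¬ (n - 1 - (v - u) = p ∧ (n : ℤ) ∣ X.left p - v) := fun b => hexcl ⟨a.2, b.2⟩
    rw [if_pos a, if_neg b, if_pos (Or.inl a)]
    ring
  · rw [if_neg a]
    by_cases b : n - 1 - (v - u) = p ∧ (n : ℤ) ∣ X.left p - v
    · rw [if_pos b, if_pos (Or.inr b)]
      ring
    · rw [if_neg b, if_neg (by tauto)]
      ring

/-- There is a monotone walk from the triangulation of `U` to that of `V` in the associahedron whose
vertices, apart from the last one, come from a list of snakes that satisfy `Φ`, have increasing area
and precede `V`. The number of times that the walk flips a diagonal is given by `flips`. -/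
def Traverses (Φ : Snake n → Prop) (U V : Snake n) : Prop :=
  ∃ (w : (associahedron n).Walk U.tri V.tri) (l : List (Snake n)),
    w.darts.map (·.fst) = l.map tri ∧ (∀ X ∈ l, Φ X ∧ U.area ≤ X.area ∧ X.area < V.area) ∧
    l.Pairwise (fun X Y => X.area < Y.area) ∧ U.area ≤ V.area ∧
    ∀ u v : ℕ, u + 2 ≤ v → v < n → v + 2 ≤ u + n →
      (w.darts.countP (fun s => (s(vtx u, vtx v) : Sym2 (Fin n)) ∈ s.fst.diagonals ∧
        s(vtx u, vtx v) ∉ s.snd.diagonals) : ℤ) = V.flips u v - U.flips u v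

theorem Traverses.mono {Φ Ψ : Snake n → Prop} {U V : Snake n} (h : Traverses Φ U V)
    (hΦ : ∀ X, Φ X → Ψ X) : Traverses Ψ U V := by
  obtain ⟨w, l, h1, h2, h3⟩ := h
  exact ⟨w, l, h1, fun X hX => ⟨hΦ X (h2 X hX).1, (h2 X hX).2⟩, h3⟩

theorem Traverses.of_eq {Φ : Snake n → Prop} {U V : Snake n}
    (h : ∀ p, 1 ≤ p → p + 3 ≤ n → U.left p = V.left p) : Traverses Φ U V := by
  refine ⟨SimpleGraph.Walk.nil.copy rfl (tri_congr h), [], ?_, by simp, by simp,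
    (area_congr h).le, fun u v h1 h2 h3 => ?_⟩
  · simp
  · simp [flips_congr h1 h3 h]

theorem Traverses.trans {Φ : Snake n → Prop} {U V W : Snake n} (h : Traverses Φ U V)
    (h' : Traverses Φ V W) : Traverses Φ U W := by
  obtain ⟨w, l, h1, h2, h3, h4, h5⟩ := h
  obtain ⟨w', l', h1', h2', h3', h4', h5'⟩ := h'
  refine ⟨w.append w', l ++ l', by simp [h1, h1'], ?_, ?_, h4.trans h4', fun u v a b c => ?_⟩
  · intro X hX
    rcases List.mem_append.1 hX with hX | hX
    · exact ⟨(h2 X hX).1, (h2 X hX).2.1, by linarith [(h2 X hX).2.2]⟩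
    · exact ⟨(h2' X hX).1, by linarith [(h2' X hX).2.1], (h2' X hX).2.2⟩
  · refine List.pairwise_append.2 ⟨h3, h3', fun X hX Y hY => ?_⟩
    linarith [(h2 X hX).2.2, (h2' Y hY).2.1]
  · rw [SimpleGraph.Walk.darts_append, List.countP_append]
    push_cast
    rw [h5 u v a b c, h5' u v a b c]
    ring

theorem IsRaise.traverses {X Y : Snake n} {p : ℕ} (h : IsRaise X Y p) :
    Traverses (· = X) X Y := by
  have hadj : (associahedron n).Adj X.tri Y.tri := h.isFlip
  refine ⟨SimpleGraph.Walk.cons hadj .nil, [X], by simp, by simp [h.area_eq], by simp,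
    by simp [h.area_eq], fun u v a b c => ?_⟩
  rw [h.flips_eq a c, ← if_congr h.mem_and_not_mem_iff rfl rfl]
  simp only [SimpleGraph.Walk.darts_cons, SimpleGraph.Walk.darts_nil, List.countP_cons,
    List.countP_nil]
  split_ifs <;> simp_all

/-- Between two comparable snakes, the lagging position of least height `2 * left p + p` can be
moved forward. -/
theorem Le.exists_isRaise {U V : Snake n} (h : Le U V)
    (hne : ∃ p, 1 ≤ p ∧ p + 3 ≤ n ∧ U.left p < V.left p) :
    ∃ W p, IsRaise U W p ∧ Le W V := by
  have hn4 := hn.out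
  let S := (Finset.Icc 1 (n - 3)).filter fun p => U.left p < V.left p
  have hS : S.Nonempty := by
    obtain ⟨p, hp, hp', hlt⟩ := hne
    exact ⟨p, Finset.mem_filter.2 ⟨Finset.mem_Icc.2 ⟨hp, by omega⟩, hlt⟩⟩
  obtain ⟨p, hpS, hmin⟩ := S.exists_min_image (fun p => 2 * U.left p + p) hS
  simp only [S, Finset.mem_filter, Finset.mem_Icc] at hpS hmin
  obtain ⟨⟨hp, hp'⟩, hlt⟩ := hpS
  have hprev : ∀ q, 1 ≤ q → q + 1 = p → U.left p = U.left q - 1 := by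
    rintro q hq rfl
    have hU := U.step q hq (by omega)
    have hV := V.step q hq (by omega)
    have hle := h q hq (by omega)
    by_contra hcon
    rcases hle.lt_or_eq with hl | hl
    · have := hmin q ⟨⟨hq, by omega⟩, hl⟩
      push_cast at this
      omega
    · omega
  have hnext : p + 4 ≤ n → U.left (p + 1) = U.left p := by
    intro hq
    have hU := U.step p hp (by omega)
    have hV := V.step p hp (by omega)
    have hle := h (p + 1) (by omega) (by omega)
    by_contra hcon
    rcases hle.lt_or_eq with hl | hl
    · have := hmin (p + 1) ⟨⟨by omega, by omega⟩, hl⟩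
      push_cast at this
      omega
    · omega
  refine ⟨⟨Function.update U.left p (U.left p + 1), fun q hq hq' => ?_⟩, p,
    ⟨hp, by omega, by simp, fun q _ _ hq => by simp [hq]⟩, fun q hq hq' => ?_⟩
  · have hU := U.step q hq hq'
    by_cases h1 : q = p
    · subst h1
      simp only [Function.update_self, Function.update_of_ne (show q + 1 ≠ q by omega)]
      have := hnext hq'
      omega
    · by_cases h2 : q + 1 = p
      · have := hprev q hq h2
        subst h2
        simp only [Function.update_self, Function.update_of_ne h1]
        omega
      · simp only [Function.update_of_ne h1, Function.update_of_ne h2]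
        exact hU
  · by_cases h1 : q = p
    · subst h1
      simp only [Function.update_self]
      omega
    · simp only [Function.update_of_ne h1]
      exact h q hq hq'

theorem Le.traverses {U V : Snake n} (h : Le U V) :
    Traverses (fun X => Le U X ∧ Le X V) U V := by
  obtain ⟨k, hk⟩ : ∃ k : ℕ, V.area - U.area = k := Int.eq_ofNat_of_zero_le (by
    linarith [h.area_le])
  induction k generalizing U with
  | zero =>
    refine .of_eq fun p hp hp' => ?_
    by_contra hne
    obtain ⟨W, q, hW, hWV⟩ := h.exists_isRaise ⟨p, hp, hp', lt_of_le_of_ne (h p hp hp') hne⟩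
    have := hW.area_eq
    have := hWV.area_le
    push_cast at hk
    linarith
  | succ k ih =>
    by_cases hne : ∃ p, 1 ≤ p ∧ p + 3 ≤ n ∧ U.left p < V.left p
    · obtain ⟨W, q, hW, hWV⟩ := h.exists_isRaise hne
      have hUW : Le U W := by
        intro p hp hp'
        by_cases hpq : p = q
        · subst hpq
          linarith [hW.eq]
        · exact (hW.eq_of_ne p hp hp' hpq).ge
      have := hW.area_eq
      refine (hW.traverses.mono ?_).trans ((ih hWV ?_).mono ?_)
      · rintro X rfl
        exact ⟨fun _ _ _ => le_rfl, h⟩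
      · push_cast at hk
        linarith
      · exact fun X hX => ⟨fun p hp hp' => (hUW p hp hp').trans (hX.1 p hp hp'), hX.2⟩
    · refine .of_eq fun p hp hp' => ?_
      push Not at hne
      exact le_antisymm (h p hp hp') (hne p hp hp')

end Snake

namespace Snake

variable {n : ℕ}

/-! ### Zigzag profiles with markers -/

/-- The snake with coordinates `⌊(f p - p) / 2⌋`. For constant `f` this is a zigzag, and in general
`f p` is the stage that the zigzag has reached at position `p`. -/
def profile (f : ℕ → ℤ) (hf : ∀ p, 1 ≤ p → p + 4 ≤ n → |f (p + 1) - f p| ≤ 1) : Snake n where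
  left p := (f p - p) / 2
  step p hp hp' := by
    have := hf p hp hp'
    rw [abs_le] at this
    push_cast
    omega

theorem profile_le {f g : ℕ → ℤ} {hf : ∀ p, 1 ≤ p → p + 4 ≤ n → |f (p + 1) - f p| ≤ 1}
    {hg : ∀ p, 1 ≤ p → p + 4 ≤ n → |g (p + 1) - g p| ≤ 1}
    (h : ∀ p, 1 ≤ p → p + 3 ≤ n → f p ≤ g p) : Le (profile f hf : Snake n) (profile g hg) := by
  intro p hp hp'
  have := h p hp hp'
  simp only [profile]
  omega

/-- A marker: a `0`-`1`-valued function that vanishes near the two ends of a snake and around the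
border between its left part, the positions up to `c`, and its right part. -/
structure IsMarker (n c : ℕ) (μ : ℕ → ℤ) : Prop where
  zero_or_one : ∀ p, μ p = 0 ∨ μ p = 1
  left_end : ∀ p, p ≤ 3 → μ p = 0
  right_end : ∀ p, n ≤ p + 5 → μ p = 0
  border : μ c = 0
  border' : μ (c + 1) = 0

/-- The zigzag of stage `s` in which the diagonals marked by `μ` have been flipped ahead, as far as
they belong to the class of diagonals that is flipped next. -/
def marked {c : ℕ} (s : ℤ) {μ : ℕ → ℤ} (hμ : IsMarker n c μ) : Snake n :=
  profile (fun p => s + μ p) fun p _ _ => by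
    have := hμ.zero_or_one p
    have := hμ.zero_or_one (p + 1)
    rw [abs_le]
    omega

/-- The first half of stage `s`: the left part is the marked zigzag of stage `s`, and the right end
has not yet left stage `s`. -/
def PhaseA (c : ℕ) (s : ℤ) (μ : ℕ → ℤ) (X : Snake n) : Prop :=
  (∀ p : ℕ, 1 ≤ p → p ≤ c → X.left p = (s + μ p - p) / 2) ∧
    ∀ p : ℕ, n ≤ p + 4 → p + 3 ≤ n → X.left p = (s - p) / 2

/-- The second half of stage `s`: the right part is the marked zigzag of stage `s + 1`, and the left
end has not yet left stage `s`. -/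
def PhaseB (c : ℕ) (s : ℤ) (μ : ℕ → ℤ) (X : Snake n) : Prop :=
  (∀ p : ℕ, c < p → p + 3 ≤ n → X.left p = (s + 1 + μ p - p) / 2) ∧
    ∀ p : ℕ, 1 ≤ p → p ≤ 2 → X.left p = (s - p) / 2

variable [hn : Fact (4 ≤ n)]

/-- One stage. The right part advances while the marker in the left part is intact, and then the
left part advances while the new marker in the right part is intact; in both cases the end of the
snake moves last. -/
theorem traverses_stage {c : ℕ} (hc : 4 ≤ c) (hcn : c + 6 ≤ n) (s : ℤ) {μ μ' : ℕ → ℤ}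
    (hμ : IsMarker n c μ) (hμ' : IsMarker n c μ') :
    Traverses (fun X => PhaseA c s μ X ∨ PhaseB c s μ' X) (marked s hμ : Snake n)
      (marked (s + 1) hμ') := by
  have hn4 := hn.out
  have key : ∀ f : ℕ → ℤ, ((∀ p, f p - s = 0 ∨ f p - s = 1 ∨ f p - s = 2)) →
      (∀ p, 1 ≤ p → p + 4 ≤ n → ¬ (f p = s ∧ f (p + 1) = s + 2)) →
      (∀ p, 1 ≤ p → p + 4 ≤ n → ¬ (f p = s + 2 ∧ f (p + 1) = s)) →
      ∀ p, 1 ≤ p → p + 4 ≤ n → |f (p + 1) - f p| ≤ 1 := by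
    intro f h0 h1 h2 p hp hp'
    have := h0 p
    have := h0 (p + 1)
    have := h1 p hp hp'
    have := h2 p hp hp'
    rw [abs_le]
    omega
  have z := hμ.zero_or_one
  have z' := hμ'.zero_or_one
  have b := hμ.border
  have b' := hμ'.border'
  have e3 : μ' (2 + 1) = 0 := hμ'.left_end 3 (by omega)
  have e5 := hμ'.right_end (n - 5) (by omega)
  let f₁ : ℕ → ℤ := fun p => if p ≤ c then s + μ p else if p + 5 ≤ n then s + 1 + μ' p else s
  let f₂ : ℕ → ℤ := fun p => if p ≤ c then s + μ p else s + 1 + μ' p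
  let f₃ : ℕ → ℤ := fun p => if p ≤ 2 then s else s + 1 + μ' p
  have h₁ : ∀ p, 1 ≤ p → p + 4 ≤ n → |f₁ (p + 1) - f₁ p| ≤ 1 := by
    refine key f₁ (fun p => ?_) (fun p hp hp' => ?_) (fun p hp hp' => ?_)
    · have := z p
      have := z' p
      simp only [f₁]
      split_ifs <;> omega
    · have := z (p + 1)
      rcases eq_or_ne p c with rfl | hpc
      · simp only [f₁]
        split_ifs <;> omega
      · have := z p
        have := z' p
        simp only [f₁]
        split_ifs <;> omega
    · rcases eq_or_ne p (n - 5) with rfl | hpc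
      · simp only [f₁]
        split_ifs <;> omega
      · have := z p
        have := z (p + 1)
        have := z' (p + 1)
        simp only [f₁]
        split_ifs <;> omega
  have h₂ : ∀ p, 1 ≤ p → p + 4 ≤ n → |f₂ (p + 1) - f₂ p| ≤ 1 := by
    refine key f₂ (fun p => ?_) (fun p hp hp' => ?_) (fun p hp hp' => ?_)
    · have := z p
      have := z' p
      simp only [f₂]
      split_ifs <;> omega
    · have := z (p + 1)
      rcases eq_or_ne p c with rfl | hpc
      · simp only [f₂]
        split_ifs <;> omega
      · have := z p
        have := z' p
        simp only [f₂]
        split_ifs <;> omega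
    · have := z p
      have := z' (p + 1)
      simp only [f₂]
      split_ifs <;> omega
  have h₃ : ∀ p, 1 ≤ p → p + 4 ≤ n → |f₃ (p + 1) - f₃ p| ≤ 1 := by
    refine key f₃ (fun p => ?_) (fun p hp hp' => ?_) (fun p hp hp' => ?_)
    · have := z' p
      simp only [f₃]
      split_ifs <;> omega
    · rcases eq_or_ne p 2 with rfl | hpc
      · simp only [f₃]
        split_ifs <;> omega
      · have := z' p
        simp only [f₃]
        split_ifs <;> omega
    · have := z' (p + 1)
      simp only [f₃]
      split_ifs <;> omega
  -- the right part advances, except for its end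
  have t₁ : Traverses (PhaseA c s μ) (marked s hμ : Snake n) (profile f₁ h₁) := by
    refine (Le.traverses (profile_le fun p hp hp' => ?_)).mono fun X hX => ⟨fun p hp hp' => ?_,
      fun p hp hp' => ?_⟩
    · have := z p
      have := z' p
      have := hμ.right_end p
      simp only [f₁]
      split_ifs <;> omega
    · have a := hX.1 p hp (by omega)
      have a' := hX.2 p hp (by omega)
      simp only [profile, f₁, if_pos hp'] at a a'
      omega
    · have a := hX.1 p (by omega) hp'
      have a' := hX.2 p (by omega) hp'
      have := hμ.right_end p (by omega)
      simp only [profile, f₁, if_neg (show ¬ p ≤ c by omega),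
        if_neg (show ¬ p + 5 ≤ n by omega)] at a a'
      omega
  -- the right end advances: of its two positions, the one with `s - p` odd moves
  have t₂ : Traverses (PhaseA c s μ) (profile f₁ h₁ : Snake n) (profile f₂ h₂) := by
    obtain ⟨p, hp, hp', hodd⟩ : ∃ p : ℕ, n ≤ p + 4 ∧ p + 3 ≤ n ∧ (s - p) % 2 = 1 := by
      rcases Int.emod_two_eq_zero_or_one (s - (n - 3 : ℕ)) with h | h
      · exact ⟨n - 4, by omega, by omega, by omega⟩
      · exact ⟨n - 3, by omega, by omega, h⟩
    have hr : IsRaise (profile f₁ h₁ : Snake n) (profile f₂ h₂) p := by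
      refine ⟨by omega, hp', ?_, fun q hq hq' hne => ?_⟩
      · have := hμ'.right_end p (by omega)
        simp only [profile, f₁, f₂, if_neg (show ¬ p ≤ c by omega),
          if_neg (show ¬ p + 5 ≤ n by omega)]
        omega
      · simp only [profile, f₁, f₂]
        split_ifs
        · rfl
        · rfl
        · have := hμ'.right_end q (by omega)
          omega
    refine hr.traverses.mono ?_
    rintro X rfl
    refine ⟨fun p hp hp' => ?_, fun p hp hp' => ?_⟩
    · simp only [profile, f₁, if_pos hp']
    · simp only [profile, f₁, if_neg (show ¬ p ≤ c by omega), if_neg (show ¬ p + 5 ≤ n by omega)]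
  -- the left part advances, except for its end
  have t₃ : Traverses (PhaseB c s μ') (profile f₂ h₂ : Snake n) (profile f₃ h₃) := by
    refine (Le.traverses (profile_le fun p hp hp' => ?_)).mono fun X hX => ⟨fun p hp hp' => ?_,
      fun p hp hp' => ?_⟩
    · have := z p
      have := z' p
      have := hμ.left_end p
      simp only [f₂, f₃]
      split_ifs <;> omega
    · have a := hX.1 p (by omega) hp'
      have a' := hX.2 p (by omega) hp'
      simp only [profile, f₂, f₃, if_neg (show ¬ p ≤ c by omega),
        if_neg (show ¬ p ≤ 2 by omega)] at a a'
      omega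
    · have a := hX.1 p hp (by omega)
      have a' := hX.2 p hp (by omega)
      have := hμ.left_end p (by omega)
      simp only [profile, f₂, f₃, if_pos (show p ≤ c by omega), if_pos hp'] at a a'
      omega
  -- the left end advances
  have t₄ : Traverses (PhaseB c s μ') (profile f₃ h₃ : Snake n) (marked (s + 1) hμ') := by
    obtain ⟨p, hp, hp', hodd⟩ : ∃ p : ℕ, 1 ≤ p ∧ p ≤ 2 ∧ (s - p) % 2 = 1 := by
      rcases Int.emod_two_eq_zero_or_one s with h | h
      · exact ⟨1, by omega, by omega, by omega⟩
      · exact ⟨2, by omega, by omega, by omega⟩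
    have hr : IsRaise (profile f₃ h₃ : Snake n) (marked (s + 1) hμ') p := by
      refine ⟨by omega, by omega, ?_, fun q hq hq' hne => ?_⟩
      · have := hμ'.left_end p (by omega)
        simp only [marked, profile, f₃, if_pos hp']
        omega
      · simp only [marked, profile, f₃]
        split_ifs
        · have := hμ'.left_end q (by omega)
          omega
        · rfl
    refine hr.traverses.mono ?_
    rintro X rfl
    refine ⟨fun p hp hp' => ?_, fun p hp hp' => ?_⟩
    · simp only [profile, f₃, if_neg (show ¬ p ≤ 2 by omega)]
    · simp only [profile, f₃, if_pos hp']
  exact ((t₁.trans t₂).mono fun X => Or.inl).trans ((t₃.trans t₄).mono fun X => Or.inr)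

end Snake

/-! ### Closed walks, flips and diagonals -/

/-- A closed walk of length at least three that starts at pairwise distinct vertices is a cycle. -/
theorem isCycle_of_nodup {V : Type*} {G : SimpleGraph V} {v : V} (w : G.Walk v v)
    (h : (w.darts.map (·.fst)).Nodup) (hl : 3 ≤ w.length) : w.IsCycle := by
  rw [SimpleGraph.Walk.isCycle_iff_isPath_tail_and_le_length]
  refine ⟨?_, hl⟩
  have hnil : ¬ w.Nil := fun hnil => by
    rw [← SimpleGraph.Walk.length_eq_zero_iff] at hnil
    omega
  rw [SimpleGraph.Walk.isPath_def, w.support_tail_of_not_nil hnil,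
    w.tail_support_perm_dropLast_support.nodup_iff, ← w.map_fst_darts]
  exact h

theorem countP_add_countP_add_countP_le {α : Type*} (l : List α) (p q r : α → Prop)
    [DecidablePred p] [DecidablePred q] [DecidablePred r] (hpq : ∀ a, p a → ¬ q a)
    (hpr : ∀ a, p a → ¬ r a) (hqr : ∀ a, q a → ¬ r a) :
    l.countP p + l.countP q + l.countP r ≤ l.length := by
  induction l with
  | nil => simp
  | cons a l ih =>
    have h1 := hpq a
    have h2 := hpr a
    have h3 := hqr a
    simp only [List.countP_cons, List.length_cons, decide_eq_true_eq]
    split_ifs <;> first | omega | tauto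

/-- A flip removes only one diagonal. -/
theorem Triangulation.IsFlip.eq_of_removed {n : ℕ} {T T' : Triangulation n}
    (h : T.IsFlip T') {d d' : Sym2 (Fin n)}
    (hd : d ∈ T.diagonals ∧ d ∉ T'.diagonals) (hd' : d' ∈ T.diagonals ∧ d' ∉ T'.diagonals) :
    d = d' := by
  obtain ⟨-, -, -, -, e, e', -, -, -, -, -, -, -, -, -, hT⟩ := h
  have key : ∀ f, f ∈ T.diagonals ∧ f ∉ T'.diagonals → f = e := by
    rintro f ⟨h1, h2⟩
    by_contra hne
    exact h2 (by rw [hT]; exact Finset.mem_insert_of_mem (Finset.mem_erase.2 ⟨hne, h1⟩))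
  rw [key d hd, key d' hd']

theorem two_mul_add_two_le_two_pow {n : ℕ} (hn : 45 ≤ n) : 2 * n + 2 ≤ 2 ^ ((n - 11) / 4) := by
  have key : ∀ b : ℕ, 8 ≤ b → 8 * b + 30 ≤ 2 ^ b := fun b hb => by
    induction b, hb using Nat.le_induction with
    | base => norm_num
    | succ b hb ih =>
      rw [pow_succ]
      omega
  have := key ((n - 11) / 4) (by omega)
  omega

theorem exists_eq_vtx_of_isDiagonal {n : ℕ} [Fact (4 ≤ n)] {d : Sym2 (Fin n)} (hd : IsDiagonal d) :
    ∃ u v : ℕ, u + 2 ≤ v ∧ v < n ∧ v + 2 ≤ u + n ∧ d = s(vtx u, vtx v) := by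
  induction d using Sym2.ind with | _ a b => ?_
  wlog hab : a ≤ b generalizing a b
  · rw [Sym2.eq_swap] at hd ⊢
    exact this b a hd (le_of_not_ge hab)
  have ha := vtx_val a
  have hb := vtx_val b
  rw [← ha, ← hb, isDiagonal_vtx] at hd
  obtain ⟨d1, d2, d3⟩ := hd
  have hbn := b.isLt
  have h1 : (a : ℕ) ≠ b := fun h => d1 (by rw [h]; simp)
  have h2 : (b : ℕ) ≠ a + 1 := fun h => d3 (by rw [h]; simp)
  have h3 : (b : ℕ) + 1 ≠ a + n := fun h => d2 ⟨-1, by omega⟩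
  rw [Fin.le_def] at hab
  exact ⟨a, b, by omega, hbn, by omega, by rw [ha, hb]⟩

namespace Snake

variable {n : ℕ}

/-! ### Markers that encode numbers -/

/-- The marker of the number `k`, read from either end of the snake: the positions `2 i + 4` and
`2 i + 5`, of which at every stage exactly one can be flipped ahead, carry the bit `i` of `k`. -/
def mark (n b k p : ℕ) : ℤ :=
  if 4 ≤ min p (n - 2 - p) ∧ min p (n - 2 - p) / 2 - 2 < b ∧
    k.testBit (min p (n - 2 - p) / 2 - 2) then 1 else 0

theorem isMarker_mark {b : ℕ} (hb : 4 * b + 11 ≤ n) (k : ℕ) :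
    IsMarker n (2 * b + 4) (mark n b k) where
  zero_or_one p := by
    unfold mark
    split_ifs
    · exact Or.inr rfl
    · exact Or.inl rfl
  left_end p hp := if_neg fun h => by omega
  right_end p hp := if_neg fun h => by omega
  border := if_neg fun h => by omega
  border' := if_neg fun h => by omega

theorem mark_symm {b k p : ℕ} (hp : p + 2 ≤ n) : mark n b k (n - 2 - p) = mark n b k p := by
  rw [mark, mark, show n - 2 - (n - 2 - p) = p by omega, min_comm]

theorem eq_of_mark_eq {b k k' : ℕ} (hb : 4 * b + 11 ≤ n) (hk : k < 2 ^ b) (hk' : k' < 2 ^ b)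
    (a : ℤ) (h : ∀ p : ℕ, 4 ≤ p → p ≤ 2 * b + 3 → (a - p) % 2 = 1 →
      mark n b k p = mark n b k' p) : k = k' := by
  refine Nat.eq_of_testBit_eq fun i => ?_
  rcases Nat.lt_or_ge i b with hi | hi
  · obtain ⟨p, hp, hodd⟩ : ∃ p : ℕ, (p = 2 * i + 4 ∨ p = 2 * i + 5) ∧ (a - p) % 2 = 1 := by
      rcases Int.emod_two_eq_zero_or_one a with h | h
      · exact ⟨2 * i + 5, Or.inr rfl, by omega⟩
      · exact ⟨2 * i + 4, Or.inl rfl, by omega⟩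
    have := h p (by omega) (by omega) hodd
    rw [mark, mark, show min p (n - 2 - p) / 2 - 2 = i by omega] at this
    have h4 : 4 ≤ min p (n - 2 - p) := by omega
    simp only [h4, hi, true_and] at this
    revert this
    cases k.testBit i <;> cases k'.testBit i <;> simp
  · have hle := Nat.pow_le_pow_right (show 0 < 2 by omega) hi
    rw [Nat.testBit_lt_two_pow (by omega), Nat.testBit_lt_two_pow (by omega)]

/-! ### Rounds -/

/-- The marker that replaces the marker of `k` in stage `s` of the round that leads from `k` to
`k'`: it is the marker of `k'` in the last stage. -/
def nextMark (n b k k' : ℕ) (s : ℤ) : ℕ → ℤ :=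
  if s = n - 1 then mark n b k' else mark n b k

/-- The snakes that occur in the round which leads from the marker of `k` to the marker of `k'`. -/
def InRound (n b k k' : ℕ) (X : Snake n) : Prop :=
  ∃ s : ℤ, 0 ≤ s ∧ s < n ∧
    (PhaseA (2 * b + 4) s (mark n b k) X ∨ PhaseB (2 * b + 4) s (nextMark n b k k' s) X)

variable [hn : Fact (4 ≤ n)]

/-- One round consists of `n` stages, after which the snake, read from its other end, is the initial
one with the new marker. -/
theorem traverses_round {b : ℕ} (hb : 4 * b + 11 ≤ n) (k k' : ℕ) :
    Traverses (InRound n b k k') (marked 0 (isMarker_mark hb k))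
      (marked 0 (isMarker_mark hb k')).glide := by
  have hm := isMarker_mark hb k
  have hm' := isMarker_mark hb k'
  have main : ∀ m : ℕ, m + 1 ≤ n →
      Traverses (InRound n b k k') (marked 0 hm) (marked (m : ℤ) hm : Snake n) := by
    intro m hm1
    induction m with
    | zero => exact .of_eq fun _ _ _ => rfl
    | succ m ih =>
      refine (ih (by omega)).trans ?_
      push_cast
      refine (traverses_stage (by omega) (by omega) (m : ℤ) hm hm).mono fun X hX => ?_
      refine ⟨m, by omega, by omega, ?_⟩
      rwa [nextMark, if_neg (by omega)]
  have last := (traverses_stage (by omega) (by omega) ((n - 1 : ℕ) : ℤ) hm hm').mono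
    (Ψ := InRound n b k k') fun X hX => by
      refine ⟨(n - 1 : ℕ), by omega, by omega, ?_⟩
      rwa [nextMark, if_pos (by omega)]
  refine ((main (n - 1) (by omega)).trans last).trans (.of_eq fun p hp hp' => ?_)
  have := mark_symm (b := b) (k := k') (show p + 2 ≤ n by omega)
  simp only [marked, profile, glide, this]
  omega

/-- The number of the round and the snake can be read off from the triangulation: the coordinates
at the two ends of the snake tell the stage and the half of the stage, and the part of the snake
that is at rest in this half shows the marker. -/
theorem InRound.eq_of_tri_eq {b r k k' : ℕ} (hb : 4 * b + 11 ≤ n) (hr : r ≤ 2 ^ b) (hk : k < r)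
    (hk' : k' < r) {X Y : Snake n} (hX : InRound n b k ((k + 1) % r) X)
    (hY : InRound n b k' ((k' + 1) % r) Y) (h : X.tri = Y.tri) :
    k = k' ∧ ∀ p, 1 ≤ p → p + 3 ≤ n → Y.left p = X.left p := by
  have clock : ∀ (k k' : ℕ) (X : Snake n) (s : ℤ),
      (PhaseA (2 * b + 4) s (mark n b k) X ∨ PhaseB (2 * b + 4) s (nextMark n b k k' s) X) →
      X.left 1 + X.left 2 = s - 2 ∧
        ((PhaseA (2 * b + 4) s (mark n b k) X ∧ X.left (n - 4) + X.left (n - 3) = s + 3 - n) ∨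
        (PhaseB (2 * b + 4) s (nextMark n b k k' s) X ∧
          X.left (n - 4) + X.left (n - 3) = s + 4 - n)) := by
    rintro k k' X s (hA | hB)
    · have m1 := (isMarker_mark hb k).left_end 1 (by omega)
      have m2 := (isMarker_mark hb k).left_end 2 (by omega)
      have a1 := hA.1 1 (by omega) (by omega)
      have a2 := hA.1 2 (by omega) (by omega)
      have a3 := hA.2 (n - 4) (by omega) (by omega)
      have a4 := hA.2 (n - 3) (by omega) (by omega)
      rw [m1] at a1
      rw [m2] at a2
      exact ⟨by omega, Or.inl ⟨hA, by omega⟩⟩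
    · have hm : IsMarker n (2 * b + 4) (nextMark n b k k' s) := by
        rw [nextMark]
        split_ifs
        exacts [isMarker_mark hb _, isMarker_mark hb _]
      have m3 := hm.right_end (n - 4) (by omega)
      have m4 := hm.right_end (n - 3) (by omega)
      have a1 := hB.2 1 (by omega) (by omega)
      have a2 := hB.2 2 (by omega) (by omega)
      have a3 := hB.1 (n - 4) (by omega) (by omega)
      have a4 := hB.1 (n - 3) (by omega) (by omega)
      rw [m3] at a3
      rw [m4] at a4
      exact ⟨by omega, Or.inr ⟨hB, by omega⟩⟩
  obtain ⟨s, hs0, hsn, hX⟩ := hX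
  obtain ⟨s', hs0', hsn', hY⟩ := hY
  obtain ⟨c1, c2⟩ := clock _ _ X s hX
  obtain ⟨c1', c2'⟩ := clock _ _ Y s' hY
  obtain ⟨m, hm⟩ := exists_eq_add_of_tri_eq h
  obtain ⟨t, ht⟩ : ∃ t : ℤ, t = n * m := ⟨_, rfl⟩
  have hdvd : (n : ℤ) ∣ t := ⟨m, ht⟩
  rw [← ht] at hm
  rcases hm with hm | hm
  · have ht0 : t = 0 := by
      have h1 := hm 1 (by omega) (by omega)
      have h2 := hm 2 (by omega) (by omega)
      exact Int.eq_zero_of_abs_lt_dvd hdvd (by rw [abs_lt]; constructor <;> omega)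
    have heq : ∀ p, 1 ≤ p → p + 3 ≤ n → Y.left p = X.left p := fun p hp hp' => by
      rw [hm p hp hp', ht0, add_zero]
    refine ⟨?_, heq⟩
    have g1 := heq 1 (by omega) (by omega)
    have g2 := heq 2 (by omega) (by omega)
    have g3 := heq (n - 4) (by omega) (by omega)
    have g4 := heq (n - 3) (by omega) (by omega)
    obtain rfl : s = s' := by omega
    rcases c2 with ⟨hA, c2⟩ | ⟨hB, c2⟩
    · rcases c2' with ⟨hA', -⟩ | ⟨-, c2'⟩
      · refine eq_of_mark_eq hb (hk.trans_le hr) (hk'.trans_le hr) s fun p hp hp' hodd => ?_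
        have a := hA.1 p (by omega) (by omega)
        have a' := hA'.1 p (by omega) (by omega)
        rw [heq p (by omega) (by omega)] at a'
        have := (isMarker_mark hb k).zero_or_one p
        have := (isMarker_mark hb k').zero_or_one p
        omega
      · omega
    · rcases c2' with ⟨-, c2'⟩ | ⟨hB', -⟩
      · omega
      · -- the right part shows the bits at the mirrored positions
        have key : ∀ j j' : ℕ, j < 2 ^ b → j' < 2 ^ b →
            PhaseB (2 * b + 4) s (mark n b j) X → PhaseB (2 * b + 4) s (mark n b j') Y →
            j = j' := by
          intro j j' hj hj' hB hB'
          refine eq_of_mark_eq hb hj hj' (s + 1 + n) fun p hp hp' hodd => ?_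
          have a := hB.1 (n - 2 - p) (by omega) (by omega)
          have a' := hB'.1 (n - 2 - p) (by omega) (by omega)
          rw [heq _ (by omega) (by omega)] at a'
          rw [mark_symm (by omega)] at a a'
          have := (isMarker_mark hb j).zero_or_one p
          have := (isMarker_mark hb j').zero_or_one p
          omega
        have hr0 : 0 < r := by omega
        by_cases hs : s = n - 1
        · rw [nextMark, if_pos hs] at hB hB'
          have := key _ _ ((Nat.mod_lt _ hr0).trans_le hr) ((Nat.mod_lt _ hr0).trans_le hr) hB hB'
          rcases Nat.lt_or_ge (k + 1) r with h1 | h1 <;>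
            rcases Nat.lt_or_ge (k' + 1) r with h2 | h2
          · rw [Nat.mod_eq_of_lt h1, Nat.mod_eq_of_lt h2] at this
            omega
          · rw [Nat.mod_eq_of_lt h1, show k' + 1 = r by omega, Nat.mod_self] at this
            omega
          · rw [Nat.mod_eq_of_lt h2, show k + 1 = r by omega, Nat.mod_self] at this
            omega
          · omega
        · rw [nextMark, if_neg hs] at hB hB'
          exact key _ _ (hk.trans_le hr) (hk'.trans_le hr) hB hB'
  · -- one of the snakes is read from its other end: then the stages would differ by an odd
    -- multiple of `n`
    exfalso
    have h1 := hm 1 (by omega) (by omega)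
    have h2 := hm 2 (by omega) (by omega)
    have h3 := hm (n - 4) (by omega) (by omega)
    have h4 := hm (n - 3) (by omega) (by omega)
    simp only [glide] at h1 h2 h3 h4
    rw [show n - 2 - 1 = n - 3 by omega] at h1
    rw [show n - 2 - 2 = n - 4 by omega] at h2
    rw [show n - 2 - (n - 4) = 2 by omega] at h3
    rw [show n - 2 - (n - 3) = 1 by omega] at h4
    have hsum : s' + n = s + 2 * t := by omega
    have hss : s' - s = 0 := by
      refine Int.eq_zero_of_abs_lt_dvd (m := n) ?_ (by rw [abs_lt]; constructor <;> omega)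
      rw [show s' - s = 2 * t - n by omega]
      exact dvd_sub (hdvd.mul_left 2) (dvd_refl _)
    exact not_dvd_of_pos_of_lt (by omega) (by omega) hdvd

/-! ### The rainbow cycle -/

/-- The first `j` of the `r` rounds form a walk without repeated vertices, except possibly the last
one. Every round adds one flip of each diagonal, up to a correction that depends only on the current
marker and that vanishes once all rounds have been made. -/
theorem exists_walk_rounds {b r : ℕ} (hb : 4 * b + 11 ≤ n) (hr : r ≤ 2 ^ b) (j : ℕ) (hj : j ≤ r) :
    ∃ (w : (associahedron n).Walk (marked 0 (isMarker_mark hb 0) : Snake n).tri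
        (marked 0 (isMarker_mark hb (j % r)) : Snake n).tri) (l : List (Snake n)),
      w.darts.map (·.fst) = l.map tri ∧
      (∀ X ∈ l, ∃ k < j, InRound n b k ((k + 1) % r) X) ∧ (l.map tri).Nodup ∧
      ∀ u v : ℕ, u + 2 ≤ v → v < n → v + 2 ≤ u + n →
        (w.darts.countP (fun s => (s(vtx u, vtx v) : Sym2 (Fin n)) ∈ s.fst.diagonals ∧
          s(vtx u, vtx v) ∉ s.snd.diagonals) : ℤ) =
        j + (marked 0 (isMarker_mark hb (j % r)) : Snake n).flips u v -
          (marked 0 (isMarker_mark hb 0) : Snake n).flips u v := by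
  induction j with
  | zero =>
    rw [Nat.zero_mod]
    exact ⟨.nil, [], by simp, by simp, by simp, by simp⟩
  | succ j ih =>
    have ih := ih (by omega)
    rw [Nat.mod_eq_of_lt (show j < r by omega)] at ih
    obtain ⟨w, l, h1, h2, h3, h4⟩ := ih
    obtain ⟨w', l', h1', h2', h3', -, h5'⟩ := traverses_round hb j ((j + 1) % r)
    refine ⟨w.append (w'.copy rfl (tri_glide _)), l ++ l', ?_, ?_, ?_, fun u v a b c => ?_⟩
    · rw [SimpleGraph.Walk.darts_append, SimpleGraph.Walk.darts_copy, List.map_append,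
        List.map_append, h1, h1']
    · intro X hX
      rcases List.mem_append.1 hX with hX | hX
      · obtain ⟨k, hk, h⟩ := h2 X hX
        exact ⟨k, by omega, h⟩
      · exact ⟨j, by omega, (h2' X hX).1⟩
    · rw [List.map_append, List.nodup_append']
      refine ⟨h3, ?_, ?_⟩
      · rw [List.Nodup, List.pairwise_map]
        refine List.Pairwise.imp_of_mem ?_ h3'
        intro X Y hX hY hlt he
        obtain ⟨-, heq⟩ := (h2' X hX).1.eq_of_tri_eq hb hr (by omega) (by omega) (h2' Y hY).1 he
        exact hlt.ne (area_congr heq).symm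
      · intro T hT hT'
        obtain ⟨X, hX, rfl⟩ := List.mem_map.1 hT
        obtain ⟨Y, hY, he⟩ := List.mem_map.1 hT'
        obtain ⟨k, hk, h⟩ := h2 X hX
        obtain ⟨hkj, -⟩ := h.eq_of_tri_eq hb hr (by omega) (by omega) (h2' Y hY).1 he.symm
        omega
    · rw [SimpleGraph.Walk.darts_append, SimpleGraph.Walk.darts_copy, List.countP_append]
      push_cast
      rw [h4 u v a b c, h5' u v a b c, flips_glide a c]
      ring

theorem exists_isRainbowCycle {r : ℕ} (h45 : 45 ≤ n) (hr : 1 ≤ r) (hr' : r ≤ 2 * n + 2) :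
    ∃ (T : Triangulation n) (C : (associahedron n).Walk T T), IsRainbowCycle r C := by
  have hb : 4 * ((n - 11) / 4) + 11 ≤ n := by omega
  have hwalk := exists_walk_rounds hb (hr'.trans (two_mul_add_two_le_two_pow h45)) r le_rfl
  rw [Nat.mod_self] at hwalk
  obtain ⟨w, l, h1, -, h3, h4⟩ := hwalk
  have hcount : ∀ d : Sym2 (Fin n), IsDiagonal d → flipCount w d = r := by
    intro d hd
    obtain ⟨u, v, a, b, c, rfl⟩ := exists_eq_vtx_of_isDiagonal hd
    have := h4 u v a b c
    rw [add_sub_cancel_right] at this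
    exact_mod_cast this
  refine ⟨_, w, isCycle_of_nodup w (h1 ▸ h3) ?_, hcount⟩
  -- three different diagonals are flipped
  have hne : ∀ i j : ℕ, i < j → j < n → ∀ s : (associahedron n).Dart,
      (s(vtx (0 : ℕ), vtx i) ∈ s.fst.diagonals ∧ s(vtx (0 : ℕ), vtx i) ∉ s.snd.diagonals) →
      ¬ (s(vtx (0 : ℕ), vtx j) ∈ s.fst.diagonals ∧ s(vtx (0 : ℕ), vtx j) ∉ s.snd.diagonals) := by
    intro i j hij hj s hi hj'
    have := Triangulation.IsFlip.eq_of_removed s.adj hi hj'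
    rw [Sym2.congr_right] at this
    have := eq_of_vtx_eq this (by omega) (by omega)
    omega
  have := countP_add_countP_add_countP_le w.darts _ _ _ (hne 2 3 (by omega) (by omega))
    (hne 2 4 (by omega) (by omega)) (hne 3 4 (by omega) (by omega))
  have e : ∀ i : ℕ, 2 ≤ i → i + 2 ≤ n → flipCount w s(vtx (0 : ℕ), vtx i) = r := fun i hi hi' =>
    hcount _ (isDiagonal_vtx_of_lt (by push_cast; omega) (by push_cast; omega))
  have e2 := e 2 (by omega) (by omega)
  have e3 := e 3 (by omega) (by omega)
  have e4 := e 4 (by omega) (by omega)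
  rw [flipCount] at e2 e3 e4
  rw [w.length_darts] at this
  omega

end Snake

/-! ### Flips and arcs of facets along a cycle -/

/-- Let a cycle start outside `F`. The components of its part in `F` correspond to the steps in
which it leaves `F`: every component is an arc, and it is left at its last vertex. -/
theorem card_components_eq_card_exits {V : Type*} {G : SimpleGraph V} {v : V} {C : G.Walk v v}
    (hC : C.IsCycle) {F : Set V} (hv : v ∉ F) (E : Finset ℕ)
    (hE : ∀ j, j ∈ E ↔ j < C.length ∧ C.getVert j ∈ F ∧ C.getVert (j + 1) ∉ F) :
    Nat.card (C.toSubgraph.induce ({x | x ∈ C.support} ∩ F)).coe.ConnectedComponent = E.card := by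
  classical
  set H := C.toSubgraph.induce ({x | x ∈ C.support} ∩ F) with hH
  have hmem : ∀ i, C.getVert i ∈ F → C.getVert i ∈ H.verts := fun i hi =>
    ⟨C.getVert_mem_support i, hi⟩
  have hlt : ∀ i, C.getVert i ∈ F → i < C.length := fun i hi => by
    by_contra hcon
    rw [C.getVert_of_length_le (not_lt.1 hcon)] at hi
    exact hv hi
  have hpos : ∀ i, C.getVert i ∈ F → 1 ≤ i := fun i hi => by
    by_contra hcon
    rw [show i = 0 by omega, C.getVert_zero] at hi
    exact hv hi
  have hinj : ∀ i j, C.getVert i ∈ F → C.getVert i = C.getVert j → i ≤ C.length →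
      j ≤ C.length → i = j := fun i j hi hij hil hjl =>
    hC.getVert_injOn ⟨hpos i hi, hil⟩ ⟨hpos j (hij ▸ hi), hjl⟩ hij
  -- the number of exits before a given time
  let e : ℕ → ℕ := fun i => (E.filter (· < i)).card
  have he_succ : ∀ i, C.getVert (i + 1) ∈ F → e (i + 1) = e i := by
    intro i hi
    refine congrArg Finset.card (Finset.filter_congr fun j hj => ?_)
    have : j ≠ i := by
      rintro rfl
      exact ((hE j).1 hj).2.2 hi
    omega
  have he_lt : ∀ i j, i ∈ E → i < j → e i < e j := by
    intro i j hi hij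
    refine Finset.card_lt_card ((Finset.ssubset_iff_of_subset ?_).2 ⟨i, ?_, ?_⟩)
    · intro k hk
      rw [Finset.mem_filter] at hk ⊢
      exact ⟨hk.1, hk.2.trans hij⟩
    · exact Finset.mem_filter.2 ⟨hi, hij⟩
    · simp
  -- it is constant on components
  have hconst : ∀ x y : H.verts, H.coe.Reachable x y → ∀ i j, i ≤ C.length → j ≤ C.length →
      C.getVert i = x → C.getVert j = y → e i = e j := by
    rintro x y ⟨w⟩
    induction w with
    | nil =>
      rename_i x
      intro i j hi hj hx hy
      rw [hinj i j (hx ▸ x.2.2) (hx.trans hy.symm) hi hj]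
    | cons hadj w ih =>
      rename_i x y z
      intro i j hi hj hx hz
      have hadj' : C.toSubgraph.Adj x y := hadj.2.2
      obtain ⟨k, hk, hkl⟩ := C.toSubgraph_adj_iff.1 hadj'
      rw [Sym2.eq_iff] at hk
      rcases hk with ⟨hkx, hky⟩ | ⟨hky, hkx⟩
      · rw [← ih (k + 1) j hkl hj hky hz, he_succ k (hky ▸ y.2.2),
          hinj i k (hx ▸ x.2.2) (hx.trans hkx.symm) hi hkl.le]
      · rw [← ih k j hkl.le hj hky hz, ← he_succ k (hkx ▸ x.2.2),
          hinj i (k + 1) (hx ▸ x.2.2) (hx.trans hkx.symm) hi hkl]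
  -- from every vertex in `F` the cycle runs in `F` up to an exit
  have hexit : ∀ m i, C.length - i = m → ∀ hi : C.getVert i ∈ F,
      ∃ j, ∃ hj : j ∈ E, H.coe.Reachable ⟨C.getVert j, hmem j ((hE j).1 hj).2.1⟩
        ⟨C.getVert i, hmem i hi⟩ := by
    intro m
    induction m with
    | zero =>
      intro i hm hi
      have := hlt i hi
      omega
    | succ m ih =>
      intro i hm hi
      by_cases hi' : C.getVert (i + 1) ∈ F
      · obtain ⟨j, hj, hr⟩ := ih (i + 1) (by omega) hi'
        refine ⟨j, hj, hr.trans (SimpleGraph.Adj.reachable ?_)⟩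
        have := C.toSubgraph_adj_getVert (hlt i hi)
        exact ⟨hmem _ hi', hmem _ hi, this.symm⟩
      · exact ⟨i, (hE i).2 ⟨hlt i hi, hi, hi'⟩, .refl _⟩
  let φ : E → H.coe.ConnectedComponent := fun j =>
    H.coe.connectedComponentMk ⟨C.getVert j, hmem j ((hE j).1 j.2).2.1⟩
  have hφ : Function.Bijective φ := by
    constructor
    · intro i j hij
      have hr := SimpleGraph.ConnectedComponent.exact hij
      have heq := hconst _ _ hr i j ((hE i).1 i.2).1.le ((hE j).1 j.2).1.le rfl rfl
      rcases lt_trichotomy (i : ℕ) j with h | h | h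
      · exact ((he_lt i j i.2 h).ne heq).elim
      · exact Subtype.ext h
      · exact ((he_lt j i j.2 h).ne' heq).elim
    · intro c
      induction c using SimpleGraph.ConnectedComponent.ind with | _ x => ?_
      obtain ⟨x, hx, hxF⟩ := x
      obtain ⟨i, rfl, -⟩ := SimpleGraph.Walk.mem_support_iff_exists_getVert.1 hx
      obtain ⟨j, hj, hr⟩ := hexit _ i rfl hxF
      exact ⟨⟨j, hj⟩, SimpleGraph.ConnectedComponent.sound hr⟩
  rw [← Nat.card_eq_of_bijective φ hφ, Nat.card_eq_fintype_card, Fintype.card_coe]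

section Arcs

variable {n : ℕ}

theorem flipCount_eq_card {T : Triangulation n} (C : (associahedron n).Walk T T)
    (d : Sym2 (Fin n)) :
    flipCount C d = {j ∈ Finset.range C.length | d ∈ (C.getVert j).diagonals ∧
      d ∉ (C.getVert (j + 1)).diagonals}.card := by
  have key : C.darts.map (fun s => decide (d ∈ s.fst.diagonals ∧ d ∉ s.snd.diagonals)) =
      (List.range C.length).map fun j => decide (d ∈ (C.getVert j).diagonals ∧
        d ∉ (C.getVert (j + 1)).diagonals) := by
    apply List.ext_getElem
    · simp
    · intro i h1 h2
      simp only [List.getElem_map, List.getElem_range,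
        SimpleGraph.Walk.darts_getElem_eq_getVert]
  have := congrArg (List.countP id) key
  rw [List.countP_map, List.countP_map] at this
  rw [flipCount, Finset.card_def, Finset.filter_val, Finset.range_val, Multiset.range,
    Multiset.filter_coe, Multiset.coe_card, ← List.countP_eq_length_filter]
  exact this

/-- A facet that does not contain the whole cycle is visited as often as its diagonal is flipped. -/
theorem facetArcs_eq_flipCount {T : Triangulation n} {C : (associahedron n).Walk T T}
    (hC : C.IsCycle) {d : Sym2 (Fin n)} {S : Triangulation n} (hS : S ∈ C.support)
    (hd : d ∉ S.diagonals) : facetArcs C d = flipCount C d := by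
  classical
  have h1 : flipCount (C.rotate S hS) d = flipCount C d :=
    (C.rotate_darts S hS).perm.countP_eq _
  have h2 : facetArcs (C.rotate S hS) d = facetArcs C d := by
    have hset : {S' | S' ∈ (C.rotate S hS).support} = {S' | S' ∈ C.support} :=
      Set.ext fun _ => C.mem_support_rotate_iff S hS
    rw [facetArcs, facetArcs, SimpleGraph.Walk.toSubgraph_rotate, hset]
  rw [← h1, ← h2, flipCount_eq_card]
  exact card_components_eq_card_exits (hC.rotate hS) hd _ fun j => by
    rw [Finset.mem_filter, Finset.mem_range]
    rfl

theorem flipCount_eq_zero_of_forall_mem {T : Triangulation n} (C : (associahedron n).Walk T T)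
    {d : Sym2 (Fin n)} (h : ∀ S ∈ C.support, d ∈ S.diagonals) : flipCount C d = 0 := by
  rw [flipCount, List.countP_eq_zero]
  intro s hs
  have := h _ (C.dart_snd_mem_support_of_mem_darts hs)
  simp [this]

theorem facetArcs_eq_zero_of_forall_not_mem {T : Triangulation n}
    (C : (associahedron n).Walk T T) {d : Sym2 (Fin n)}
    (h : ∀ S ∈ C.support, d ∉ S.diagonals) : facetArcs C d = 0 := by
  have : IsEmpty (C.toSubgraph.induce ({S | S ∈ C.support} ∩ facet d)).verts :=
    ⟨fun x => h _ x.2.1 x.2.2⟩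
  have : IsEmpty (C.toSubgraph.induce ({S | S ∈ C.support} ∩ facet d)).coe.ConnectedComponent :=
    ⟨fun c => by
      induction c using SimpleGraph.ConnectedComponent.ind with | _ x => exact isEmptyElim x⟩
  rw [facetArcs, Nat.card_of_isEmpty]

theorem exists_crosses_of_isDiagonal [Fact (4 ≤ n)] {d : Sym2 (Fin n)} (hd : IsDiagonal d) :
    ∃ d', IsDiagonal d' ∧ Crosses d d' := by
  obtain ⟨u, v, h1, h2, h3, rfl⟩ := exists_eq_vtx_of_isDiagonal hd
  exact ⟨s(vtx (u + 1), vtx (v + 1)), isDiagonal_vtx_of_lt (by omega) (by omega),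
    crosses_vtx (by omega) (by omega) (by omega) (by omega)⟩

theorem forall_flipCount_iff_forall_facetArcs [Fact (4 ≤ n)] {r : ℕ} (hr : 1 ≤ r)
    {T : Triangulation n} {C : (associahedron n).Walk T T} (hC : C.IsCycle) :
    (∀ d : Sym2 (Fin n), IsDiagonal d → flipCount C d = r) ↔
      ∀ d : Sym2 (Fin n), IsDiagonal d → facetArcs C d = r := by
  constructor
  · intro h d hd
    obtain ⟨S, hS, hdS⟩ : ∃ S ∈ C.support, d ∉ S.diagonals := by
      by_contra! hcon
      have := flipCount_eq_zero_of_forall_mem C hcon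
      have := h d hd
      omega
    rw [facetArcs_eq_flipCount hC hS hdS, h d hd]
  · intro h d hd
    obtain ⟨S, hS, hdS⟩ : ∃ S ∈ C.support, d ∉ S.diagonals := by
      by_contra! hcon
      -- a diagonal that crosses `d` would belong to no triangulation of the cycle
      obtain ⟨d', hd', hcr⟩ := exists_crosses_of_isDiagonal hd
      have := facetArcs_eq_zero_of_forall_not_mem C (d := d') fun S hS hmem =>
        S.noncrossing d (hcon S hS) d' hmem hcr
      have := h d' hd'
      omega
    rw [← facetArcs_eq_flipCount hC hS hdS, h d hd]

end Arcs

theorem mainTheorem2 (n r : ℕ) (hn : 45 ≤ n) (hr : 1 ≤ r) (hr' : r ≤ 2 * n + 2) :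
    (∃ (T : Triangulation n) (C : (associahedron n).Walk T T), IsRainbowCycle r C) ∧
    (∀ (T : Triangulation n) (C : (associahedron n).Walk T T), C.IsCycle →
      ((∀ d : Sym2 (Fin n), IsDiagonal d → flipCount C d = r) ↔
        (∀ d : Sym2 (Fin n), IsDiagonal d → facetArcs C d = r))) := by
  have : Fact (4 ≤ n) := ⟨by omega⟩
  exact ⟨Snake.exists_isRainbowCycle hn hr hr',
    fun _ _ hC => forall_flipCount_iff_forall_facetArcs hr hC⟩
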